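/- Model. In the congested clique model, $n$ nodes communicate in synchronous rounds; in each round every node may send to every other node a (possibly different) message of $\lceil\log_2 n\rceil$ bits, and local computation is free. For integers $n,m,M\ge 1$ let $\mathrm{DIST}(n,m,M)$ be the following problem: given an $n\times m$ matrix $A$ and an $m\times n$ matrix $B$ with entries in $\{-M,\dots,M\}\cup\{\infty\}$, where node $\ell\in\{1,\dots,n\}$ initially has row $\ell$ of $A$ and column $\ell$ of $B$, compute the distance product $C=A*B$, $C[i,j]=\min_{1\le s\le m}(A[i,s]+B[s,j])$, so that at the end node $\ell$ has row $\ell$ and column $\ell$ of $C$. Its deterministic round complexity is the least number of rounds in which a deterministic algorithm solves every instance. Exponent. An algebraic algorithm of rank $t$ for the product of an $n\times m$ by an $m\times n$ matrix over a field $\mathbb F$ consists of coefficients $\alpha_{ij\mu},\beta_{ij\mu},\lambda_{ij\mu}\in\mathbb F$ with $(AB)[i,j]=\sum_{\mu=1}^t\lambda_{ij\mu}S^{(\mu)}T^{(\mu)}$ for all $A,B$ and all $i,j$, where $S^{(\mu)}=\sum_{i',j'}\alpha_{i'j'\mu}A[i',j']$ and $T^{(\mu)}=\sum_{i',j'}\beta_{i'j'\mu}B[j',i']$.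 Fix $q\in\mathbb N$. For $\gamma\ge 0$ let $\omega(\gamma)$ be the smallest $\tau$ such that for every $\varepsilon>0$ the product of an $n\times\lceil n^\gamma\rceil$ by an $\lceil n^\gamma\rceil\times n$ matrix has an algebraic algorithm of rank $O(n^{\tau+\varepsilon})$, uniformly over all finite fields of characteristic at least $q$ (for $q=0$: over all finite fields). Theorem. Let $\log$ be the logarithm to base 2. For all integers $1\le M\le n$ and $2\le m\le n$, the deterministic round complexity of $\mathrm{DIST}(n,m,M)$ is $$\begin{cases}O(M\log m)&\text{if } m\le\sqrt{Mn\log m},\\[2pt] O\big((M\log m)^{2/(\omega(\gamma)+\varepsilon)}\,n^{1-2/(\omega(\gamma)+\varepsilon)}\big)\ \text{for every fixed }\varepsilon>0&\text{if }\sqrt{Mn\log m}\le m\le n^2/(M\log m),\\[2pt] O(mM\log m/n)&\text{if } n^2/(M\log m)\le m\le n.\end{cases}$$ The constants in the first and third bound are absolute, and the one in the second bound depends only on $\varepsilon$ and $q$. In the second case $\gamma\ge0$ is the solution of $$\Big(1-\frac{\log M}{\log n}\Big)\gamma=1-\frac{\log M}{\log n}+\Big(\frac{\log m}{\log n}-1\Big)\omega(\gamma),$$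 which always exists in that range (the bound holds for every solution $\gamma\ge 0$). -/

import Mathlib

/-! ### The congested clique model -/

/-- A deterministic algorithm for the congested clique with `n` nodes: in every round each node sends
to each node a message of `b` bits, which depends on the sender, on its current local state and on
the addressee. Local computation is unrestricted. `I` is the type of local inputs and `O` the type
of local outputs. -/
structure CliqueAlgorithm (n b : ℕ) (I O : Type) where
  State : Type
  start : Fin n → I → State
  send : Fin n → State → Fin n → (Fin b → Bool)
  receive : Fin n → State → (Fin n → Fin b → Bool) → State
  output : Fin n → State → O

namespace CliqueAlgorithm

variable {n b : ℕ} {I O : Type}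

/-- The local state of each node after `t` synchronous rounds, on input `x`. -/
def stateAfter (P : CliqueAlgorithm n b I O) (x : Fin n → I) : ℕ → Fin n → P.State
  | 0, v => P.start v (x v)
  | t + 1, v =>
      P.receive v (P.stateAfter x t v) (fun u => P.send u (P.stateAfter x t u) v)

/-- The local output of each node after `t` rounds, on input `x`. -/
def outputAfter (P : CliqueAlgorithm n b I O) (x : Fin n → I) (t : ℕ) (v : Fin n) : O :=
  P.output v (P.stateAfter x t v)

end CliqueAlgorithm

/-! ### The distance product -/

/-- The distance (min-plus) product, `⊤` being the entry `∞`. -/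
def distProduct {n m : ℕ} (A : Matrix (Fin n) (Fin m) (WithTop ℤ))
    (B : Matrix (Fin m) (Fin n) (WithTop ℤ)) : Matrix (Fin n) (Fin n) (WithTop ℤ) :=
  fun i j => Finset.univ.inf (fun s : Fin m => A i s + B s j)

/-- All entries lie in `{-M, …, M} ∪ {∞}`. -/
def EntriesBounded {p r : ℕ} (M : ℕ) (A : Matrix (Fin p) (Fin r) (WithTop ℤ)) : Prop :=
  ∀ i j, A i j = ⊤ ∨ ∃ z : ℤ, A i j = (z : WithTop ℤ) ∧ |z| ≤ (M : ℤ)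

/-- The algorithm `P` computes within `T` rounds the distance product of every `n × m` matrix `A`
and every `m × n` matrix `B` with entries in `{-M, …, M} ∪ {∞}`: node `v` initially has row `v` of
`A` and column `v` of `B`, and finally has row `v` and column `v` of the product. -/
def ComputesDist (n m M b T : ℕ)
    (P : CliqueAlgorithm n b ((Fin m → WithTop ℤ) × (Fin m → WithTop ℤ))
      ((Fin n → WithTop ℤ) × (Fin n → WithTop ℤ))) : Prop :=
  ∀ (A : Matrix (Fin n) (Fin m) (WithTop ℤ)) (B : Matrix (Fin m) (Fin n) (WithTop ℤ)),
    EntriesBounded M A → EntriesBounded M B →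
    ∀ v : Fin n,
      P.outputAfter (fun u => (fun s => A u s, fun s => B s u)) T v =
        (fun j => distProduct A B v j, fun i => distProduct A B i v)

/-- The deterministic round complexity of the distance product problem for `(n, m, M)` in the
congested clique with messages of `⌈log₂ n⌉` bits is at most `R`. -/
def DistRoundsLE (n m M : ℕ) (R : ℝ) : Prop :=
  ∃ T : ℕ, (T : ℝ) ≤ R ∧ ∃ P, ComputesDist n m M (Nat.clog 2 n) T P

/-! ### Algebraic algorithms and the exponent of rectangular matrix multiplication -/

/-- There is an algebraic (bilinear) algorithm of rank `t` for the product of an `n × m` matrix by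
an `m × n` matrix over `F`. -/
def HasAlgebraicAlgorithm (F : Type) [Field F] (n m t : ℕ) : Prop :=
  ∃ (α β : Fin n → Fin m → Fin t → F) (lam : Fin n → Fin n → Fin t → F),
    ∀ (A : Matrix (Fin n) (Fin m) F) (B : Matrix (Fin m) (Fin n) F) (i j : Fin n),
      (A * B) i j = ∑ μ, lam i j μ *
        (∑ i', ∑ j', α i' j' μ * A i' j') * (∑ i', ∑ j', β i' j' μ * B j' i')

/-- For every `ε > 0`, the product of an `n × ⌈n ^ γ⌉` matrix by an `⌈n ^ γ⌉ × n` matrix can be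
computed by an algebraic algorithm of rank `O(n ^ (τ + ε))`, uniformly over all finite fields of
characteristic at least `q`. -/
def IsMMExponentBound (q : ℕ) (γ τ : ℝ) : Prop :=
  ∀ ε : ℝ, 0 < ε → ∃ K : ℝ, ∀ (F : Type) [Field F] [Finite F], q ≤ ringChar F →
    ∀ n : ℕ, 1 ≤ n → ∃ t : ℕ, (t : ℝ) ≤ K * (n : ℝ) ^ (τ + ε) ∧
      HasAlgebraicAlgorithm F n ⌈(n : ℝ) ^ γ⌉₊ t

/-- The exponent `ω(γ)` of rectangular matrix multiplication over the finite fields of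
characteristic at least `q` (all finite fields if `q = 0`). -/
noncomputable def mmExponent (q : ℕ) (γ : ℝ) : ℝ :=
  sInf {τ : ℝ | IsMMExponentBound q γ τ}

/-- `γ` is a (nonnegative) solution of the equation
`(1 - log M / log n) γ = 1 - log M / log n + (log m / log n - 1) ω(γ)`. -/
def IsBalancedExponent (q n m M : ℕ) (γ : ℝ) : Prop :=
  0 ≤ γ ∧
    (1 - Real.log M / Real.log n) * γ =
      1 - Real.log M / Real.log n + (Real.log m / Real.log n - 1) * mmExponent q γ

/-!
By edge colouring of bipartite multigraphs, any communication pattern in which each node sends and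
receives at most `L * n` messages takes `O(L)` rounds. An entry `z` is encoded as the monomial
`X ^ (z + M)` over `𝔽_p`, and `∞` as `0`: the lowest exponent of an entry of the product of the
encoded matrices is a distance, because its coefficient counts at most `m < p` witnesses. The
product has degree at most `4 * M`, so it is interpolated from `4 * M + 1` products over `𝔽_p`. Each
of these is computed in blocks of size `d × e` by a fast bilinear algorithm whose products are
distributed over the nodes. Collecting the inputs and the results of a block product costs about
`m / (d * e)` and `n / d ^ 2` rounds; the balanced exponent `γ` makes the two terms equal when
`e = d ^ γ` and `d ^ ω(γ) = n / M`.
-/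
namespace CliqueAlgorithm

variable {n b : ℕ} {I O O' : Type}

/-- The algorithm `P` followed by the local computation `h`. -/
def mapOutput (P : CliqueAlgorithm n b I O) (h : Fin n → O → O') : CliqueAlgorithm n b I O' where
  State := P.State
  start := P.start
  send := P.send
  receive := P.receive
  output v s := h v (P.output v s)

theorem stateAfter_mapOutput (P : CliqueAlgorithm n b I O) (h : Fin n → O → O') (x : Fin n → I)
    (t : ℕ) : (P.mapOutput h).stateAfter x t = P.stateAfter x t := by
  induction t with
  | zero => rfl
  | succ t ih => funext v; simp only [stateAfter, ih]; rfl

theorem outputAfter_mapOutput (P : CliqueAlgorithm n b I O) (h : Fin n → O → O') (x : Fin n → I)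
    (t : ℕ) (v : Fin n) : (P.mapOutput h).outputAfter x t v = h v (P.outputAfter x t v) := by
  simp only [outputAfter, stateAfter_mapOutput]; rfl

/-- The algorithm that runs `P` for `T` rounds and then performs one more round, in which the
messages `msg` are computed from the outputs of `P` and evaluated by `h`. The nodes carry a clock
to know when to switch. -/
def appendRound (P : CliqueAlgorithm n b I O) (T : ℕ) (msg : Fin n → O → Fin n → Fin b → Bool)
    (h : Fin n → O → (Fin n → Fin b → Bool) → O') : CliqueAlgorithm n b I O' where
  State := (ℕ × P.State) ⊕ O'
  start v i := .inl (0, P.start v i)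
  send v
    | .inl (t, s) => if t < T then P.send v s else msg v (P.output v s)
    | .inr _ => fun _ _ => false
  receive v
    | .inl (t, s), w => if t < T then .inl (t + 1, P.receive v s w) else .inr (h v (P.output v s) w)
    | .inr o, _ => .inr o
  output v
    | .inl (_, s) => h v (P.output v s) fun _ _ => false
    | .inr o => o

theorem stateAfter_appendRound (P : CliqueAlgorithm n b I O) (T : ℕ)
    (msg : Fin n → O → Fin n → Fin b → Bool) (h : Fin n → O → (Fin n → Fin b → Bool) → O')
    (x : Fin n → I) {t : ℕ} (ht : t ≤ T) :
    (P.appendRound T msg h).stateAfter x t = fun v => .inl (t, P.stateAfter x t v) := by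
  induction t with
  | zero => rfl
  | succ t ih =>
    funext v
    simp only [stateAfter, ih (by lia)]
    simp only [appendRound, if_pos (show t < T by lia)]

theorem outputAfter_appendRound (P : CliqueAlgorithm n b I O) (T : ℕ)
    (msg : Fin n → O → Fin n → Fin b → Bool) (h : Fin n → O → (Fin n → Fin b → Bool) → O')
    (x : Fin n → I) (v : Fin n) :
    (P.appendRound T msg h).outputAfter x (T + 1) v =
      h v (P.outputAfter x T v) fun u => msg u (P.outputAfter x T u) v := by
  simp only [outputAfter, stateAfter, stateAfter_appendRound P T msg h x le_rfl]
  simp only [appendRound, lt_irrefl, if_false]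

theorem exists_exchange_fin (P : CliqueAlgorithm n b I O) (T c : ℕ)
    (msg : Fin n → O → Fin n → Fin c → Fin b → Bool) :
    ∃ P' : CliqueAlgorithm n b I (O × (Fin n → Fin c → Fin b → Bool)), ∀ x v,
      P'.outputAfter x (T + c) v =
        (P.outputAfter x T v, fun u => msg u (P.outputAfter x T u) v) := by
  induction c with
  | zero =>
    refine ⟨P.mapOutput fun _ o => (o, fun _ i => i.elim0), fun x v => ?_⟩
    rw [add_zero, outputAfter_mapOutput]
    exact Prod.ext rfl (funext₂ fun _ i => i.elim0)
  | succ c ih =>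
    obtain ⟨P', hP'⟩ := ih fun u o v i => msg u o v i.castSucc
    refine ⟨P'.appendRound (T + c) (fun u o v => msg u o.1 v (Fin.last c))
      fun _ o w => (o.1, fun u => Fin.snoc (α := fun _ => Fin b → Bool) (o.2 u) (w u)),
      fun x v => ?_⟩
    rw [← add_assoc, outputAfter_appendRound]
    simp only [hP']
    exact Prod.ext rfl (funext fun u =>
      Fin.snoc_init_self (α := fun _ => Fin b → Bool) (msg u (P.outputAfter x T u) v))

theorem exists_exchange {K : Type} [Fintype K] (P : CliqueAlgorithm n b I O) (T : ℕ)
    (msg : Fin n → O → Fin n → K → Fin b → Bool) :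
    ∃ P' : CliqueAlgorithm n b I (O × (Fin n → K → Fin b → Bool)), ∀ x v,
      P'.outputAfter x (T + Fintype.card K) v =
        (P.outputAfter x T v, fun u => msg u (P.outputAfter x T u) v) := by
  let index := Fintype.equivFin K
  obtain ⟨P', hP'⟩ := P.exists_exchange_fin T (Fintype.card K)
    fun u o v i => msg u o v (index.symm i)
  refine ⟨P'.mapOutput fun _ o => (o.1, fun u k => o.2 u (index k)), fun x v => ?_⟩
  simp only [outputAfter_mapOutput, hP', Equiv.symm_apply_apply]

end CliqueAlgorithm

/-- On every instance `ω`, given to the nodes as `input ω`, each value `φ ω e` can be made known to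
the node `loc e` within `T` rounds. What a node holds for values located elsewhere is arbitrary. -/
def KnownInRounds {n : ℕ} (b : ℕ) {Ω : Type*} {I E F : Type} (input : Ω → Fin n → I) (T : ℕ)
    (loc : E → Fin n) (φ : Ω → E → F) : Prop :=
  ∃ P : CliqueAlgorithm n b I (E → F), ∀ ω e, P.outputAfter (input ω) T (loc e) e = φ ω e

theorem exists_binary_code {F : Type*} [Nonempty F] {b c : ℕ} {V : Finset F}
    (hV : V.card ≤ 2 ^ (b * c)) :
    ∃ (enc : F → Fin c → Fin b → Bool) (dec : (Fin c → Fin b → Bool) → F),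
      ∀ a ∈ V, dec (enc a) = a := by
  obtain ⟨enc, -, henc⟩ := V.finite_toSet.exists_injOn_of_encard_le
    (t := (Set.univ : Set (Fin c → Fin b → Bool)))
    (by simpa [Set.encard_coe_eq_coe_finsetCard, ← pow_mul] using by exact_mod_cast hV)
  exact ⟨enc, Function.invFunOn enc V, fun a ha => henc.leftInvOn_invFunOn ha⟩

theorem colorable_of_forall_degree_lt {V : Type*} [Fintype V] (G : SimpleGraph V)
    [DecidableRel G.Adj] {k : ℕ} (hk : ∀ v, G.degree v < k) : G.Colorable k := by
  classical
  have colorable_on : ∀ s : Finset V, ∃ col : V → Fin k,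
      ∀ v ∈ s, ∀ w ∈ s, G.Adj v w → col v ≠ col w := by
    intro s
    induction s using Finset.induction_on with
    | empty => exact ⟨fun v => ⟨0, (Nat.zero_le _).trans_lt (hk v)⟩, by simp⟩
    | insert a s ha ih =>
      obtain ⟨col, hcol⟩ := ih
      obtain ⟨κ, -, hκ⟩ : ∃ κ ∈ Finset.univ, κ ∉ (G.neighborFinset a).image col := by
        refine Finset.exists_mem_notMem_of_card_lt_card (Finset.card_image_le.trans_lt ?_)
        simpa using hk a
      have hκ_ne : ∀ w, G.Adj a w → col w ≠ κ := fun w hw h =>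
        hκ (Finset.mem_image.2 ⟨w, by simpa using hw, h⟩)
      refine ⟨Function.update col a κ, fun v hv w hw hvw => ?_⟩
      by_cases hva : v = a <;> by_cases hwa : w = a
      · exact absurd (hva.trans hwa.symm) hvw.ne
      · subst hva
        simpa [hwa] using (hκ_ne w hvw).symm
      · subst hwa
        simpa [hva] using hκ_ne v hvw.symm
      · simpa [hva, hwa] using hcol v (Finset.mem_of_mem_insert_of_ne hv hva) w
          (Finset.mem_of_mem_insert_of_ne hw hwa) hvw
  obtain ⟨col, hcol⟩ := colorable_on Finset.univ
  exact ⟨SimpleGraph.Coloring.mk col fun {v w} => hcol v (Finset.mem_univ v) w (Finset.mem_univ w)⟩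

theorem exists_bipartite_edge_coloring {E U W K : Type*} [Fintype E] [Fintype K] [DecidableEq U]
    [DecidableEq W] (src : E → U) (dst : E → W) {Δ : ℕ} (hK : 2 * Δ ≤ Fintype.card K)
    (hsrc : ∀ u, (Finset.univ.filter (src · = u)).card ≤ Δ)
    (hdst : ∀ w, (Finset.univ.filter (dst · = w)).card ≤ Δ) :
    ∃ col : E → K, (Function.Injective fun e => (src e, col e)) ∧
      Function.Injective fun e => (dst e, col e) := by
  classical
  let G : SimpleGraph E := SimpleGraph.fromRel fun e e' => src e = src e' ∨ dst e = dst e'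
  have degree_lt : ∀ e, G.degree e < 2 * Δ := by
    intro e
    have hsub : G.neighborFinset e ⊆ (Finset.univ.filter (src · = src e)).erase e ∪
        (Finset.univ.filter (dst · = dst e)).erase e := by
      intro e' he'
      simp only [SimpleGraph.mem_neighborFinset, SimpleGraph.fromRel_adj, G] at he'
      simp only [Finset.mem_union, Finset.mem_erase, Finset.mem_filter, Finset.mem_univ, true_and]
      grind
    have hcard := (Finset.card_le_card hsub).trans (Finset.card_union_le _ _)
    rw [SimpleGraph.card_neighborFinset_eq_degree, Finset.card_erase_of_mem (by simp),
      Finset.card_erase_of_mem (by simp)] at hcard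
    have hpos : 0 < (Finset.univ.filter (src · = src e)).card := Finset.card_pos.2 ⟨e, by simp⟩
    have := hsrc (src e)
    have := hdst (dst e)
    lia
  let col := (colorable_of_forall_degree_lt G degree_lt).toColoring hK
  have hcol : ∀ e e', col e = col e' → src e = src e' ∨ dst e = dst e' → e = e' := by
    intro e e' hc h
    by_contra hne
    exact col.valid ((SimpleGraph.fromRel_adj _ _ _).2 ⟨hne, Or.inl h⟩) hc
  refine ⟨col, fun e e' h => ?_, fun e e' h => ?_⟩ <;> obtain ⟨h₁, h₂⟩ := Prod.mk.inj h
  · exact hcol e e' h₂ (Or.inl h₁)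
  · exact hcol e e' h₂ (Or.inr h₁)

theorem card_filter_eq_le_of_injective {E U J : Type*} [Fintype E] [Fintype J] [DecidableEq U]
    {f : E → U} {slot : E → J} (h : Function.Injective fun e => (f e, slot e)) (u : U) :
    (Finset.univ.filter (f · = u)).card ≤ Fintype.card J := by
  refine Finset.card_le_card_of_injOn slot (fun _ _ => Finset.mem_univ _) fun e he e' he' hs => ?_
  exact h (Prod.ext ((Finset.mem_filter.1 he).2.trans (Finset.mem_filter.1 he').2.symm) hs)

namespace KnownInRounds

variable {n b T c : ℕ} {Ω : Type*} {I E E' F F' : Type} {input : Ω → Fin n → I}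
  {loc : E → Fin n} {φ : Ω → E → F}

theorem of_input (loc : E → Fin n) (h : E → I → F) :
    KnownInRounds b input 0 loc fun ω e => h e (input ω (loc e)) :=
  ⟨⟨I, fun _ i => i, fun _ _ _ _ => false, fun _ s _ => s, fun _ s e => h e s⟩,
    fun _ _ => rfl⟩

theorem compute (hφ : KnownInRounds b input T loc φ) {loc' : E' → Fin n} {φ' : Ω → E' → F'}
    (op : E' → (E → F) → F')
    (hop : ∀ ω e' r, (∀ e, loc e = loc' e' → r e = φ ω e) → op e' r = φ' ω e') :
    KnownInRounds b input T loc' φ' := by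
  obtain ⟨P, hP⟩ := hφ
  refine ⟨P.mapOutput fun _ r e' => op e' r, fun ω e' => ?_⟩
  rw [CliqueAlgorithm.outputAfter_mapOutput]
  exact hop ω e' _ fun e he => he ▸ hP ω e

variable [Nonempty F] {V : Finset F}

theorem deliver {J : Type} [Fintype J] (hφ : KnownInRounds b input T loc φ)
    (hV : V.card ≤ 2 ^ (b * c)) (hφV : ∀ ω e, φ ω e ∈ V) {dst : E → Fin n} {slot : E → J}
    (hinj : Function.Injective fun e => (loc e, dst e, slot e)) :
    KnownInRounds b input (T + Fintype.card J * c) dst φ := by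
  obtain ⟨P, hP⟩ := hφ
  obtain ⟨enc, dec, hdec⟩ := exists_binary_code hV
  obtain ⟨P', hP'⟩ := P.exists_exchange (K := J × Fin c) T fun u r v k =>
    Function.extend (fun e => (loc e, dst e, slot e)) (fun e => enc (r e)) default (u, v, k.1) k.2
  refine ⟨P'.mapOutput fun _ o e => dec fun i => o.2 (loc e) (slot e, i), fun ω e => ?_⟩
  rw [CliqueAlgorithm.outputAfter_mapOutput]
  have hT : T + Fintype.card J * c = T + Fintype.card (J × Fin c) := by simp
  rw [hT, hP']
  dsimp only
  rw [hinj.extend_apply _ _ e, hP, hdec _ (hφV ω e)]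

/-- The pattern of the messages is known in advance, so the relays can be chosen by an edge
colouring of the bipartite multigraph of senders and addressees. -/
theorem route [Fintype E] {L : ℕ} (hφ : KnownInRounds b input T loc φ)
    (hV : V.card ≤ 2 ^ (b * c)) (hφV : ∀ ω e, φ ω e ∈ V) {dst : E → Fin n}
    (hloc : ∀ v, (Finset.univ.filter (loc · = v)).card ≤ n * L)
    (hdst : ∀ v, (Finset.univ.filter (dst · = v)).card ≤ n * L) :
    KnownInRounds b input (T + 4 * L * c) dst φ := by
  obtain ⟨col, hcol_loc, hcol_dst⟩ := exists_bipartite_edge_coloring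
    (K := Fin n × Fin (2 * L)) loc dst (by simp; lia) hloc hdst
  have hrelay := hφ.deliver hV hφV (dst := fun e => (col e).1) (slot := fun e => (col e).2) hcol_loc
  have harrive := hrelay.deliver hV hφV (dst := dst) (slot := fun e => (col e).2) fun e e' h =>
    hcol_dst (by grind)
  convert harrive using 1
  rw [Fintype.card_fin]
  ring

end KnownInRounds

/-- The entries of the distance problem, `{-M, …, M} ∪ {∞}`. -/
noncomputable def boundedEntries (M : ℕ) : Finset (WithTop ℤ) :=
  insert ⊤ ((Finset.Icc (-M : ℤ) M).image (↑))

theorem mem_boundedEntries {M : ℕ} {a : WithTop ℤ} :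
    a ∈ boundedEntries M ↔ a = ⊤ ∨ ∃ z : ℤ, a = z ∧ |z| ≤ M := by
  simp only [boundedEntries, Finset.mem_insert, Finset.mem_image, Finset.mem_Icc, abs_le]
  grind

theorem card_boundedEntries_le (M : ℕ) : (boundedEntries M).card ≤ 2 * M + 2 := by
  refine (Finset.card_insert_le _ _).trans (Nat.succ_le_succ (Finset.card_image_le.trans ?_))
  rw [Int.card_Icc]
  lia

theorem boundedEntries_mono : Monotone boundedEntries := fun _ _ _ =>
  Finset.insert_subset_insert _
    (Finset.image_subset_image (Finset.Icc_subset_Icc (by lia) (by lia)))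

theorem add_mem_boundedEntries {M N : ℕ} {a b : WithTop ℤ} (ha : a ∈ boundedEntries M)
    (hb : b ∈ boundedEntries N) : a + b ∈ boundedEntries (M + N) := by
  rw [mem_boundedEntries] at *
  rcases ha with rfl | ⟨z, rfl, hz⟩
  · exact Or.inl (top_add _)
  rcases hb with rfl | ⟨w, rfl, hw⟩
  · exact Or.inl (add_top _)
  · refine Or.inr ⟨z + w, WithTop.coe_add z w, ?_⟩
    push_cast
    exact (abs_add_le z w).trans (add_le_add hz hw)

theorem inf_mem_boundedEntries {ι : Type*} {M : ℕ} (s : Finset ι) {a : ι → WithTop ℤ}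
    (ha : ∀ i ∈ s, a i ∈ boundedEntries M) : s.inf a ∈ boundedEntries M :=
  Finset.inf_induction (Finset.mem_insert_self _ _)
    (fun x hx y hy => by rcases min_choice x y with h | h <;> simpa only [h]) ha

theorem entriesBounded_iff {p r M : ℕ} {A : Matrix (Fin p) (Fin r) (WithTop ℤ)} :
    EntriesBounded M A ↔ ∀ i j, A i j ∈ boundedEntries M :=
  forall₂_congr fun _ _ => mem_boundedEntries.symm

section DistPolynomial

open Polynomial

variable {F ι : Type*} [Field F] [Fintype ι] {M : ℕ}

/-- The encoding of the entry `z` as the monomial `X ^ (z + M)`, and of the entry `∞` as `0`. It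
turns the minimum in the distance product into a lowest exponent. -/
noncomputable def entryMonomial (F : Type*) [Field F] (M : ℕ) (a : WithTop ℤ) : F[X] :=
  (a.map fun z : ℤ => X ^ (z + M).toNat).untopD 0

theorem coeff_entryMonomial_mul {a b : WithTop ℤ} (ha : a ∈ boundedEntries M)
    (hb : b ∈ boundedEntries M) (c : ℕ) :
    (entryMonomial F M a * entryMonomial F M b).coeff c =
      if a + b = ((c - 2 * M : ℤ) : WithTop ℤ) then 1 else 0 := by
  rw [mem_boundedEntries] at ha hb
  rcases ha with rfl | ⟨z, rfl, hz⟩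
  · rw [top_add, if_neg WithTop.top_ne_coe]
    simp [entryMonomial]
  rcases hb with rfl | ⟨w, rfl, hw⟩
  · rw [add_top, if_neg WithTop.top_ne_coe]
    simp [entryMonomial]
  rw [abs_le] at hz hw
  simp only [entryMonomial, WithTop.map_coe, WithTop.untopD_coe, ← pow_add, coeff_X_pow,
    ← WithTop.coe_add, WithTop.coe_inj]
  exact if_congr (by lia) rfl rfl

/-- The product of a row `a` and a column `b` of encoded entries, as a polynomial. -/
noncomputable def distPolynomial (F : Type*) [Field F] (M : ℕ) (a b : ι → WithTop ℤ) : F[X] :=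
  ∑ s, entryMonomial F M (a s) * entryMonomial F M (b s)

variable {a b : ι → WithTop ℤ}

theorem coeff_distPolynomial (ha : ∀ s, a s ∈ boundedEntries M)
    (hb : ∀ s, b s ∈ boundedEntries M) (c : ℕ) :
    (distPolynomial F M a b).coeff c =
      (Finset.univ.filter fun s => a s + b s = ((c - 2 * M : ℤ) : WithTop ℤ)).card := by
  simp only [distPolynomial, finsetSum_coeff, coeff_entryMonomial_mul (ha _) (hb _),
    Finset.sum_boole]

theorem eval_distPolynomial (x : F) :
    (distPolynomial F M a b).eval x =
      ∑ s, (entryMonomial F M (a s)).eval x * (entryMonomial F M (b s)).eval x := by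
  simp only [distPolynomial, eval_finsetSum, eval_mul]

theorem degree_distPolynomial_lt (ha : ∀ s, a s ∈ boundedEntries M)
    (hb : ∀ s, b s ∈ boundedEntries M) :
    (distPolynomial F M a b).degree < (4 * M + 1 : ℕ) := by
  rw [degree_lt_iff_coeff_zero]
  intro c hc
  rw [coeff_distPolynomial ha hb, Finset.filter_false_of_mem, Finset.card_empty, Nat.cast_zero]
  intro s _ hs
  rcases mem_boundedEntries.1 (add_mem_boundedEntries (ha s) (hb s)) with h | ⟨z, h, hz⟩
  · exact WithTop.top_ne_coe (h.symm.trans hs)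
  · have := WithTop.coe_injective (h.symm.trans hs)
    rw [abs_le] at hz
    lia

/-- The characteristic exceeds the number of witnesses, so witnesses of the same value cannot
cancel. -/
theorem mem_support_distPolynomial {p : ℕ} [CharP F p] (hp : Fintype.card ι < p)
    (ha : ∀ s, a s ∈ boundedEntries M) (hb : ∀ s, b s ∈ boundedEntries M) {c : ℕ} :
    c ∈ (distPolynomial F M a b).support ↔
      ∃ s, a s + b s = ((c - 2 * M : ℤ) : WithTop ℤ) := by
  rw [mem_support_iff, coeff_distPolynomial ha hb, Ne, CharP.cast_eq_zero_iff F p,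
    Nat.dvd_iff_mod_eq_zero, Nat.mod_eq_of_lt ((Finset.card_le_univ _).trans_lt hp),
    ← Ne, Finset.card_ne_zero, Finset.filter_nonempty_iff]
  simp only [Finset.mem_univ, true_and]

/-- The entry of the distance product encoded by a polynomial. The shift is `2 * M` because the
encodings of both factors are shifted by `M`. -/
noncomputable def lowestExponent (M : ℕ) (p : F[X]) : WithTop ℤ :=
  p.support.inf fun c => ((c - 2 * M : ℤ) : WithTop ℤ)

theorem lowestExponent_distPolynomial {p : ℕ} [CharP F p] (hp : Fintype.card ι < p)
    (ha : ∀ s, a s ∈ boundedEntries M) (hb : ∀ s, b s ∈ boundedEntries M) :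
    lowestExponent M (distPolynomial F M a b) = Finset.univ.inf fun s => a s + b s := by
  apply le_antisymm
  · refine Finset.le_inf fun s _ => ?_
    rcases mem_boundedEntries.1 (add_mem_boundedEntries (ha s) (hb s)) with h | ⟨z, h, hz⟩
    · exact h ▸ le_top
    · rw [abs_le] at hz
      have hval : (((z + 2 * M).toNat - 2 * M : ℤ) : WithTop ℤ) = a s + b s := by
        rw [h]
        exact congrArg _ (by lia)
      exact hval ▸ Finset.inf_le ((mem_support_distPolynomial hp ha hb).2 ⟨s, hval.symm⟩)
  · refine Finset.le_inf fun c hc => ?_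
    obtain ⟨s, hs⟩ := (mem_support_distPolynomial hp ha hb).1 hc
    exact hs ▸ Finset.inf_le (Finset.mem_univ s)

theorem lowestExponent_interpolate {p : ℕ} [CharP F p] (hp : Fintype.card ι < p)
    (ha : ∀ s, a s ∈ boundedEntries M) (hb : ∀ s, b s ∈ boundedEntries M)
    {point : Fin (4 * M + 1) → F} (hpoint : Function.Injective point) :
    lowestExponent M (Lagrange.interpolate Finset.univ point fun κ =>
        (distPolynomial F M a b).eval (point κ)) =
      Finset.univ.inf fun s => a s + b s := by
  rw [← Lagrange.eq_interpolate hpoint.injOn, lowestExponent_distPolynomial hp ha hb]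
  simpa using degree_distPolynomial_lt ha hb

end DistPolynomial

section BilinearAlgorithm

variable {ι κ τ δ ε X Y F : Type*}

theorem sum_mul_extend [Fintype κ] [Fintype ε] [NonUnitalNonAssocSemiring F] (h : κ ↪ ε)
    (g : ε → F) (a : κ → F) :
    ∑ k, g k * Function.extend h a 0 k = ∑ s, g (h s) * a s := by
  symm
  refine Fintype.sum_of_injective h h.injective _ _ (fun k hk => ?_) fun s => ?_
  · rw [Function.extend_apply' _ _ _ hk, Pi.zero_apply, mul_zero]
  · rw [h.injective.extend_apply]

theorem sum_mul_extend_mk [DecidableEq Y] [Finite Y] [Fintype κ] [Fintype ε]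
    [NonUnitalNonAssocSemiring F] (h : κ ↪ ε × Y) (g : ε → F) (a : κ → F) (y : Y) :
    ∑ k, g k * Function.extend h a 0 (k, y) =
      ∑ s, if (h s).2 = y then g (h s).1 * a s else 0 := by
  cases nonempty_fintype Y
  simpa [Fintype.sum_prod_type] using sum_mul_extend h (fun p => if p.2 = y then g p.1 else 0) a

/-- The linear form with coefficients `coef · · μ` in the entries of `A`. -/
def linearForm [Fintype ι] [Fintype κ] [NonUnitalNonAssocSemiring F] (coef : ι → κ → τ → F)
    (μ : τ) (A : Matrix ι κ F) : F :=
  ∑ i, ∑ j, coef i j μ * A i j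

/-- The coefficients `α`, `β`, `lam` form an algebraic algorithm for the product of two matrices,
with index types in place of numbers of rows, of columns and of multiplications. -/
def IsBilinearAlgorithm [Fintype ι] [Fintype κ] [Fintype τ] [CommSemiring F]
    (α β : ι → κ → τ → F) (lam : ι → ι → τ → F) : Prop :=
  ∀ (A : Matrix ι κ F) (B : Matrix κ ι F) (i j : ι),
    (A * B) i j = ∑ μ, lam i j μ * linearForm α μ A * linearForm β μ B.transpose

theorem IsBilinearAlgorithm.hasAlgebraicAlgorithm {F : Type} [Field F] [Fintype τ] {n m : ℕ}
    {α β : Fin n → Fin m → τ → F} {lam : Fin n → Fin n → τ → F}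
    (halg : IsBilinearAlgorithm α β lam) : HasAlgebraicAlgorithm F n m (Fintype.card τ) := by
  let index := (Fintype.equivFin τ).symm
  refine ⟨fun i j ν => α i j (index ν), fun i j ν => β i j (index ν),
    fun i j ν => lam i j (index ν), fun A B i j => ?_⟩
  rw [halg, ← index.sum_comp]
  rfl

/-- The entries at position `(x, y)` of all blocks of `Z`, as a matrix indexed by the blocks: the
embedding `f` sends a row to its block and its position therein, `h` does the same for columns, and
the places that are not hit are filled with zeros. -/
noncomputable def blockSlice [Zero F] (f : ι ↪ δ × X) (h : κ ↪ ε × Y) (Z : Matrix ι κ F) (x : X)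
    (y : Y) : Matrix δ ε F :=
  fun i' j' => Function.extend f (fun i => Function.extend h (Z i) 0 (j', y)) 0 (i', x)

theorem blockSlice_apply [Zero F] (f : ι ↪ δ × X) (h : κ ↪ ε × Y) (Z : Matrix ι κ F) (i : ι) (y : Y)
    (j' : ε) : blockSlice f h Z (f i).2 y (f i).1 j' = Function.extend h (Z i) 0 (j', y) :=
  f.injective.extend_apply _ _ _

theorem linearForm_blockSlice [DecidableEq X] [DecidableEq Y] [Finite X] [Finite Y] [Fintype ι]
    [Fintype κ] [Fintype δ] [Fintype ε] [NonUnitalNonAssocSemiring F] (f : ι ↪ δ × X)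
    (h : κ ↪ ε × Y) (coef : δ → ε → τ → F) (μ : τ) (Z : Matrix ι κ F) (x : X) (y : Y) :
    linearForm coef μ (blockSlice f h Z x y) =
      ∑ i, ∑ s, if (f i).2 = x ∧ (h s).2 = y then coef (f i).1 (h s).1 μ * Z i s else 0 := by
  simp only [linearForm, blockSlice]
  rw [Finset.sum_comm]
  simp only [sum_mul_extend_mk f]
  rw [Finset.sum_comm]
  refine Finset.sum_congr rfl fun i _ => ?_
  simp only [sum_mul_extend_mk h, Finset.sum_ite_irrel, Finset.sum_const_zero, ite_and]

theorem IsBilinearAlgorithm.sum_mul_eq_sum_blockSlice [Fintype κ] [Fintype τ] [Fintype δ]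
    [Fintype ε] [Fintype Y] [CommSemiring F] {α β : δ → ε → τ → F} {lam : δ → δ → τ → F}
    (halg : IsBilinearAlgorithm α β lam) (f : ι ↪ δ × X) (h : κ ↪ ε × Y) (A B : Matrix ι κ F)
    (i j : ι) :
    ∑ s, A i s * B j s = ∑ μ, lam (f i).1 (f j).1 μ *
      ∑ y, linearForm α μ (blockSlice f h A (f i).2 y) *
        linearForm β μ (blockSlice f h B (f j).2 y) := by
  calc ∑ s, A i s * B j s
      = ∑ s, Function.extend h (A i) 0 (h s) * B j s := by simp only [h.injective.extend_apply]
    _ = ∑ y, ∑ j', Function.extend h (A i) 0 (j', y) * Function.extend h (B j) 0 (j', y) := by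
        rw [← sum_mul_extend h, Fintype.sum_prod_type_right]
    _ = ∑ y, (blockSlice f h A (f i).2 y * (blockSlice f h B (f j).2 y).transpose)
          (f i).1 (f j).1 := by
        simp only [Matrix.mul_apply, Matrix.transpose_apply, blockSlice_apply]
    _ = _ := by
        simp only [halg _ _ (f i).1 (f j).1, Matrix.transpose_transpose, Finset.mul_sum, mul_assoc]
        exact Finset.sum_comm

end BilinearAlgorithm

theorem hasAlgebraicAlgorithm_iff {F : Type} [Field F] {n m t : ℕ} :
    HasAlgebraicAlgorithm F n m t ↔ ∃ (α β : Fin n → Fin m → Fin t → F)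
      (lam : Fin n → Fin n → Fin t → F), IsBilinearAlgorithm α β lam :=
  Iff.rfl

theorem hasAlgebraicAlgorithm_one (F : Type) [Field F] (n : ℕ) :
    HasAlgebraicAlgorithm F n 1 (n * n) := by
  have halg : IsBilinearAlgorithm (F := F) (fun (i : Fin n) (_ : Fin 1) (ν : Fin n × Fin n) =>
      if ν.1 = i then 1 else 0) (fun i _ ν => if ν.2 = i then 1 else 0)
      (fun i j ν => if ν = (i, j) then 1 else 0) := fun A B i j => by
    simp [linearForm, Matrix.mul_apply]
  simpa using halg.hasAlgebraicAlgorithm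

theorem HasAlgebraicAlgorithm.split {F : Type} [Field F] {n m m' r t : ℕ}
    (halg : HasAlgebraicAlgorithm F n m t) (hm : m' ≤ m * r) :
    HasAlgebraicAlgorithm F n m' (r * t) := by
  obtain ⟨α, β, lam, halg⟩ := hasAlgebraicAlgorithm_iff.1 halg
  obtain ⟨h⟩ : Nonempty (Fin m' ↪ Fin m × Fin r) :=
    Function.Embedding.nonempty_of_card_le (by simpa using hm)
  obtain ⟨f, hf⟩ : ∃ f : Fin n ↪ Fin n × Unit, ∀ i, f i = (i, ()) :=
    ⟨(Equiv.prodPUnit (Fin n)).symm.toEmbedding, fun _ => rfl⟩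
  let part (coef : Fin n → Fin m → Fin t → F) (i : Fin n) (s : Fin m') (ν : Fin r × Fin t) : F :=
    if (h s).2 = ν.1 then coef i (h s).1 ν.2 else 0
  have hpart : ∀ coef y μ Z, linearForm coef μ (blockSlice f h Z () y) =
      linearForm (part coef) (y, μ) Z := fun coef y μ Z => by
    rw [linearForm_blockSlice]
    simp only [hf, true_and, linearForm, part, ite_mul, zero_mul]
  have hsplit : IsBilinearAlgorithm (part α) (part β) fun i j ν => lam i j ν.2 := by
    intro A B i j
    rw [Matrix.mul_apply, Fintype.sum_prod_type_right]
    refine (halg.sum_mul_eq_sum_blockSlice f h A B.transpose i j).trans ?_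
    simp only [hf, hpart, Finset.mul_sum, mul_assoc]
  simpa using hsplit.hasAlgebraicAlgorithm

theorem HasAlgebraicAlgorithm.sq_le {F : Type} [Field F] {n m t : ℕ}
    (halg : HasAlgebraicAlgorithm F n m t) (hm : 1 ≤ m) : n * n ≤ t := by
  obtain ⟨α, β, lam, halg⟩ := hasAlgebraicAlgorithm_iff.1 halg
  let coef (μ : Fin t) : Matrix (Fin n) (Fin n) F := fun i j => lam i j μ
  have mul_mem_span : ∀ (A : Matrix (Fin n) (Fin m) F) (B : Matrix (Fin m) (Fin n) F),
      A * B ∈ Submodule.span F (Set.range coef) := by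
    intro A B
    have hAB : A * B = ∑ μ, (linearForm α μ A * linearForm β μ B.transpose) • coef μ := by
      ext i j
      rw [halg A B i j, Matrix.sum_apply]
      exact Finset.sum_congr rfl fun μ _ => (mul_assoc _ _ _).trans (mul_comm _ _)
    exact hAB ▸ sum_mem fun μ _ =>
      Submodule.smul_mem _ _ (Submodule.subset_span (Set.mem_range_self μ))
  have span_eq_top : Submodule.span F (Set.range coef) = ⊤ := by
    refine eq_top_iff.2 fun C _ => ?_
    rw [Matrix.matrix_eq_sum_single C]
    refine sum_mem fun i _ => sum_mem fun j _ => ?_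
    have hsingle := mul_mem_span (Matrix.single i (⟨0, hm⟩ : Fin m) (C i j))
      (Matrix.single ⟨0, hm⟩ j 1)
    rwa [Matrix.single_mul_single_same, mul_one] at hsingle
  have hrank := finrank_range_le_card (R := F) coef
  rw [Set.finrank, span_eq_top, finrank_top, Module.finrank_matrix] at hrank
  simpa using hrank

/-- An instance of the distance product problem. -/
structure DistInstance (n m M : ℕ) where
  left : Matrix (Fin n) (Fin m) (WithTop ℤ)
  right : Matrix (Fin m) (Fin n) (WithTop ℤ)
  entriesBounded_left : EntriesBounded M left
  entriesBounded_right : EntriesBounded M right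

namespace DistInstance

variable {n m M : ℕ}

variable (n m M) in
/-- The initial local inputs of the nodes. -/
def input (ω : DistInstance n m M) (u : Fin n) : (Fin m → WithTop ℤ) × (Fin m → WithTop ℤ) :=
  (fun s => ω.left u s, fun s => ω.right s u)

/-- The two factors in the form in which node `i` initially has the `i`-th row of each: the left
factor (`true`) and the transpose of the right factor (`false`). -/
def factor (ω : DistInstance n m M) (σ : Bool) : Matrix (Fin n) (Fin m) (WithTop ℤ) :=
  if σ then ω.left else ω.right.transpose

theorem factor_mem (ω : DistInstance n m M) (σ : Bool) (i : Fin n) (s : Fin m) :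
    ω.factor σ i s ∈ boundedEntries M := by
  cases σ
  · exact entriesBounded_iff.1 ω.entriesBounded_right s i
  · exact entriesBounded_iff.1 ω.entriesBounded_left i s

theorem distProduct_mem (ω : DistInstance n m M) (i j : Fin n) :
    distProduct ω.left ω.right i j ∈ boundedEntries (2 * M) :=
  two_mul M ▸ inf_mem_boundedEntries _ fun s _ =>
    add_mem_boundedEntries (ω.factor_mem true i s) (ω.factor_mem false j s)

end DistInstance

/-- A distribution of the multiplication of block matrices over `F` among `n` nodes. The matrices
are divided into `d × e` blocks of format `n₁ × m₁`. A node gathers the entries at the at most `P`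
positions that it owns, multiplies at most `Q` pairs of blocks, and collects the entries of the
product at at most `P` positions. Everything is done for `4 * M + 1` evaluation points. -/
structure BlockScheme (F : Type) [Field F] (M n m d e t n₁ m₁ P Q : ℕ) where
  rows : Fin n ↪ Fin d × Fin n₁
  cols : Fin m ↪ Fin e × Fin m₁
  owner : Fin n₁ × Fin m₁ ↪ Fin n × Fin P
  worker : Fin (4 * M + 1) × Fin t ↪ Fin n × Fin Q
  collector : Fin n₁ × Fin n₁ ↪ Fin n × Fin P
  point : Fin (4 * M + 1) ↪ F
  coef : Bool → Fin d → Fin e → Fin t → F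
  lam : Fin d → Fin d → Fin t → F
  isBilinearAlgorithm : IsBilinearAlgorithm (coef true) (coef false) lam

namespace BlockScheme

variable {F : Type} [Field F] {M n m d e t n₁ m₁ P Q : ℕ}

theorem nonempty_of_le [Fintype F] (hF : 4 * M + 1 ≤ Fintype.card F)
    (halg : HasAlgebraicAlgorithm F d e t) (hrows : n ≤ d * n₁) (hcols : m ≤ e * m₁)
    (howner : n₁ * m₁ ≤ n * P) (hcollector : n₁ * n₁ ≤ n * P)
    (hworker : (4 * M + 1) * t ≤ n * Q) :
    Nonempty (BlockScheme F M n m d e t n₁ m₁ P Q) := by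
  obtain ⟨α, β, lam, halg⟩ := hasAlgebraicAlgorithm_iff.1 halg
  have hembed : ∀ {α β : Type} [Fintype α] [Fintype β], Fintype.card α ≤ Fintype.card β →
      Nonempty (α ↪ β) := Function.Embedding.nonempty_of_card_le
  obtain ⟨rows⟩ : Nonempty (Fin n ↪ Fin d × Fin n₁) := hembed (by simpa using hrows)
  obtain ⟨cols⟩ : Nonempty (Fin m ↪ Fin e × Fin m₁) := hembed (by simpa using hcols)
  obtain ⟨owner⟩ : Nonempty (Fin n₁ × Fin m₁ ↪ Fin n × Fin P) := hembed (by simpa using howner)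
  obtain ⟨worker⟩ : Nonempty (Fin (4 * M + 1) × Fin t ↪ Fin n × Fin Q) :=
    hembed (by simpa using hworker)
  obtain ⟨collector⟩ : Nonempty (Fin n₁ × Fin n₁ ↪ Fin n × Fin P) :=
    hembed (by simpa using hcollector)
  obtain ⟨point⟩ : Nonempty (Fin (4 * M + 1) ↪ F) := hembed (by simpa using hF)
  exact ⟨⟨rows, cols, owner, worker, collector, point, fun σ => if σ then α else β, lam, halg⟩⟩

variable {b c L T : ℕ}

theorem le_mul_of_mul_le (S : BlockScheme F M n m d e t n₁ m₁ P Q) (hn : 0 < n)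
    (hL : P * (d * e) ≤ n * L) : m ≤ n * L := by
  have hrows : n ≤ d * n₁ := by simpa using Fintype.card_le_of_embedding S.rows
  have hcols : m ≤ e * m₁ := by simpa using Fintype.card_le_of_embedding S.cols
  have howner : n₁ * m₁ ≤ n * P := by simpa using Fintype.card_le_of_embedding S.owner
  refine Nat.le_of_mul_le_mul_left ?_ hn
  calc n * m ≤ (d * n₁) * (e * m₁) := Nat.mul_le_mul hrows hcols
    _ = (n₁ * m₁) * (d * e) := by ring
    _ ≤ (n * P) * (d * e) := Nat.mul_le_mul_right _ howner
    _ = n * (P * (d * e)) := by ring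
    _ ≤ n * (n * L) := Nat.mul_le_mul_left _ hL

theorem le_mul_of_mul_self_le (S : BlockScheme F M n m d e t n₁ m₁ P Q) (hn : 0 < n)
    (hL : P * (d * d) ≤ n * L) : n ≤ n * L := by
  have hrows : n ≤ d * n₁ := by simpa using Fintype.card_le_of_embedding S.rows
  have hcollector : n₁ * n₁ ≤ n * P := by simpa using Fintype.card_le_of_embedding S.collector
  refine Nat.le_of_mul_le_mul_left ?_ hn
  calc n * n ≤ (d * n₁) * (d * n₁) := Nat.mul_le_mul hrows hrows
    _ = (n₁ * n₁) * (d * d) := by ring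
    _ ≤ (n * P) * (d * d) := Nat.mul_le_mul_right _ hcollector
    _ = n * (P * (d * d)) := by ring
    _ ≤ n * (n * L) := Nat.mul_le_mul_left _ hL

variable (S : BlockScheme F M n m d e t n₁ m₁ P Q)

/-- The encoding of a matrix of entries, evaluated at the point `κ`. -/
noncomputable def encode (κ : Fin (4 * M + 1)) (Z : Matrix (Fin n) (Fin m) (WithTop ℤ)) :
    Matrix (Fin n) (Fin m) F :=
  Z.map fun a => (entryMonomial F M a).eval (S.point κ)

/-- The entry at position `e.2.1` of the linear combination of the blocks of the factor `e.1` needed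
for the evaluation point and the block multiplication `e.2.2`. -/
noncomputable def combination (ω : DistInstance n m M)
    (e : Bool × (Fin n₁ × Fin m₁) × Fin (4 * M + 1) × Fin t) : F :=
  linearForm (S.coef e.1) e.2.2.2
    (blockSlice S.rows S.cols (S.encode e.2.2.1 (ω.factor e.1)) e.2.1.1 e.2.1.2)

/-- The entry at position `e.2` of the block product `e.1`. -/
noncomputable def productEntry (ω : DistInstance n m M)
    (e : (Fin (4 * M + 1) × Fin t) × Fin n₁ × Fin n₁) : F :=
  ∑ y, S.combination ω (true, (e.2.1, y), e.1) * S.combination ω (false, (e.2.2, y), e.1)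

theorem eval_distPolynomial_eq (ω : DistInstance n m M) (κ : Fin (4 * M + 1)) (i j : Fin n) :
    (distPolynomial F M (ω.factor true i) (ω.factor false j)).eval (S.point κ) =
      ∑ μ, S.lam (S.rows i).1 (S.rows j).1 μ *
        S.productEntry ω ((κ, μ), (S.rows i).2, (S.rows j).2) :=
  (eval_distPolynomial _).trans <| S.isBilinearAlgorithm.sum_mul_eq_sum_blockSlice S.rows S.cols
    (S.encode κ (ω.factor true)) (S.encode κ (ω.factor false)) i j

theorem entries_knownInRounds (hV : (boundedEntries M).card ≤ 2 ^ (b * c))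
    (hL : P * (d * e) ≤ n * L) :
    KnownInRounds b (DistInstance.input n m M) (8 * L * c)
      (fun e : Bool × Fin n × Fin m => (S.owner ((S.rows e.2.1).2, (S.cols e.2.2).2)).1)
      (fun ω e => ω.factor e.1 e.2.1 e.2.2) := by
  have hinput : KnownInRounds b (DistInstance.input n m M) 0
      (fun e : Bool × Fin n × Fin m => e.2.1) (fun ω e => ω.factor e.1 e.2.1 e.2.2) := by
    convert KnownInRounds.of_input (fun e : Bool × Fin n × Fin m => e.2.1)
      (fun e (x : (Fin m → WithTop ℤ) × (Fin m → WithTop ℤ)) =>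
        if e.1 then x.1 e.2.2 else x.2 e.2.2) using 1
    funext ω ⟨σ, i, s⟩
    cases σ <;> rfl
  convert hinput.route (L := 2 * L) hV (fun ω e => ω.factor_mem _ _ _) (fun v => ?_)
    (fun v => ?_) using 1
  · ring
  · have hload := card_filter_eq_le_of_injective (f := fun e : Bool × Fin n × Fin m => e.2.1)
      (slot := fun e => (e.1, e.2.2)) (by rintro ⟨σ, i, s⟩ ⟨σ', i', s'⟩ h; grind) v
    have := S.le_mul_of_mul_le v.pos hL
    simp only [Fintype.card_prod, Fintype.card_bool, Fintype.card_fin] at hload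
    linarith
  · have hload := card_filter_eq_le_of_injective
      (f := fun e : Bool × Fin n × Fin m => (S.owner ((S.rows e.2.1).2, (S.cols e.2.2).2)).1)
      (slot := fun e => (e.1, (S.owner ((S.rows e.2.1).2, (S.cols e.2.2).2)).2,
        (S.rows e.2.1).1, (S.cols e.2.2).1)) (by
        rintro ⟨σ, i, s⟩ ⟨σ', i', s'⟩ h
        have := S.owner.injective.eq_iff (a := ((S.rows i).2, (S.cols s).2))
          (b := ((S.rows i').2, (S.cols s').2))
        have := S.rows.injective.eq_iff (a := i) (b := i')
        have := S.cols.injective.eq_iff (a := s) (b := s')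
        grind) v
    simp only [Fintype.card_prod, Fintype.card_bool, Fintype.card_fin] at hload
    linarith

theorem combination_knownInRounds [Fintype F] (hF : Fintype.card F ≤ 2 ^ (b * c))
    (hentries : KnownInRounds b (DistInstance.input n m M) T
      (fun e : Bool × Fin n × Fin m => (S.owner ((S.rows e.2.1).2, (S.cols e.2.2).2)).1)
      (fun ω e => ω.factor e.1 e.2.1 e.2.2)) :
    KnownInRounds b (DistInstance.input n m M) (T + 2 * (P * Q) * c)
      (fun e => (S.worker e.2.2).1) S.combination := by
  have hcombination := hentries.compute (loc' := fun e => (S.owner e.2.1).1) (φ' := S.combination)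
    (fun e r => linearForm (S.coef e.1) e.2.2.2 (blockSlice S.rows S.cols
      (S.encode e.2.2.1 (Matrix.of fun i s => r (e.1, i, s))) e.2.1.1 e.2.1.2))
    fun ω e r hr => by
      rw [combination, linearForm_blockSlice, linearForm_blockSlice]
      refine Finset.sum_congr rfl fun i _ => Finset.sum_congr rfl fun s _ => ?_
      refine if_ctx_congr Iff.rfl (fun hpos => ?_) fun _ => rfl
      rw [encode, encode, Matrix.map_apply, Matrix.map_apply, Matrix.of_apply,
        hr (e.1, i, s) (by rw [hpos.1, hpos.2])]
  convert hcombination.deliver (V := Finset.univ) hF (fun _ _ => Finset.mem_univ _)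
    (dst := fun e => (S.worker e.2.2).1)
    (slot := fun e => (e.1, (S.owner e.2.1).2, (S.worker e.2.2).2)) ?_ using 1
  · simp [mul_assoc]
  · rintro ⟨σ, p, w⟩ ⟨σ', p', w'⟩ h
    have := S.owner.injective.eq_iff (a := p) (b := p')
    have := S.worker.injective.eq_iff (a := w) (b := w')
    grind

theorem productEntry_knownInRounds [Fintype F] (hF : Fintype.card F ≤ 2 ^ (b * c))
    (hcombination : KnownInRounds b (DistInstance.input n m M) T
      (fun e => (S.worker e.2.2).1) S.combination) :
    KnownInRounds b (DistInstance.input n m M) (T + P * Q * c)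
      (fun e => (S.collector e.2).1) S.productEntry := by
  have hproduct := hcombination.compute (loc' := fun e => (S.worker e.1).1) (φ' := S.productEntry)
    (fun e r => ∑ y, r (true, (e.2.1, y), e.1) * r (false, (e.2.2, y), e.1))
    fun ω e r hr => Finset.sum_congr rfl fun y _ => by rw [hr _ rfl, hr _ rfl]
  convert hproduct.deliver (V := Finset.univ) hF (fun _ _ => Finset.mem_univ _)
    (dst := fun e => (S.collector e.2).1)
    (slot := fun e => ((S.collector e.2).2, (S.worker e.1).2)) ?_ using 1
  · simp
  · rintro ⟨w, p⟩ ⟨w', p'⟩ h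
    have := S.worker.injective.eq_iff (a := w) (b := w')
    have := S.collector.injective.eq_iff (a := p) (b := p')
    grind

theorem distProduct_knownInRounds {p : ℕ} [CharP F p] (hp : m < p)
    (hV : (boundedEntries (2 * M)).card ≤ 2 ^ (b * c)) (hL : P * (d * d) ≤ n * L)
    (hproduct : KnownInRounds b (DistInstance.input n m M) T
      (fun e => (S.collector e.2).1) S.productEntry) :
    KnownInRounds b (DistInstance.input n m M) (T + 8 * L * c)
      (fun e : Bool × Fin n × Fin n => if e.1 then e.2.1 else e.2.2)
      (fun ω e => distProduct ω.left ω.right e.2.1 e.2.2) := by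
  have hdist := hproduct.compute
    (loc' := fun e : Bool × Fin n × Fin n =>
      (S.collector ((S.rows e.2.1).2, (S.rows e.2.2).2)).1)
    (φ' := fun ω e => distProduct ω.left ω.right e.2.1 e.2.2)
    (fun e r => lowestExponent M (Lagrange.interpolate Finset.univ S.point fun κ =>
      ∑ μ, S.lam (S.rows e.2.1).1 (S.rows e.2.2).1 μ *
        r ((κ, μ), (S.rows e.2.1).2, (S.rows e.2.2).2)))
    fun ω e r hr => by
      simp only [fun κ μ => hr ((κ, μ), (S.rows e.2.1).2, (S.rows e.2.2).2) rfl,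
        ← S.eval_distPolynomial_eq]
      exact lowestExponent_interpolate (by simpa using hp) (ω.factor_mem true _)
        (ω.factor_mem false _) S.point.injective
  convert hdist.route (L := 2 * L) hV (fun ω e => ω.distProduct_mem _ _) (fun v => ?_)
    (fun v => ?_) using 1
  · ring
  · have hload := card_filter_eq_le_of_injective
      (f := fun e : Bool × Fin n × Fin n => (S.collector ((S.rows e.2.1).2, (S.rows e.2.2).2)).1)
      (slot := fun e => (e.1, (S.collector ((S.rows e.2.1).2, (S.rows e.2.2).2)).2,
        (S.rows e.2.1).1, (S.rows e.2.2).1)) (by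
        rintro ⟨σ, i, j⟩ ⟨σ', i', j'⟩ h
        have := S.collector.injective.eq_iff (a := ((S.rows i).2, (S.rows j).2))
          (b := ((S.rows i').2, (S.rows j').2))
        have := S.rows.injective.eq_iff (a := i) (b := i')
        have := S.rows.injective.eq_iff (a := j) (b := j')
        grind) v
    simp only [Fintype.card_prod, Fintype.card_bool, Fintype.card_fin] at hload
    linarith
  · have hload := card_filter_eq_le_of_injective
      (f := fun e : Bool × Fin n × Fin n => if e.1 then e.2.1 else e.2.2)
      (slot := fun e => (e.1, if e.1 then e.2.2 else e.2.1)) (by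
        rintro ⟨σ, i, j⟩ ⟨σ', i', j'⟩ h
        grind) v
    have := S.le_mul_of_mul_self_le v.pos hL
    simp only [Fintype.card_prod, Fintype.card_bool, Fintype.card_fin] at hload
    linarith

end BlockScheme

theorem BlockScheme.exists_computesDist {F : Type} [Field F] [Fintype F] {p : ℕ} [CharP F p]
    {M n m d e t n₁ m₁ P Q b c L : ℕ} (S : BlockScheme F M n m d e t n₁ m₁ P Q) (hp : m < p)
    (hFM : 4 * M + 2 ≤ Fintype.card F) (hF : Fintype.card F ≤ 2 ^ (b * c))
    (hde : P * (d * e) ≤ n * L) (hdd : P * (d * d) ≤ n * L) :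
    ∃ A, ComputesDist n m M b (c * (16 * L + 3 * (P * Q))) A := by
  have hV : (boundedEntries (2 * M)).card ≤ 2 ^ (b * c) :=
    (card_boundedEntries_le _).trans (by lia)
  have hentries := S.entries_knownInRounds
    ((Finset.card_le_card (boundedEntries_mono (by lia))).trans hV) hde
  obtain ⟨A, hA⟩ := S.distProduct_knownInRounds hp hV hdd <| S.productEntry_knownInRounds hF <|
    S.combination_knownInRounds hF hentries
  refine ⟨A.mapOutput fun v r => (fun j => r (true, v, j), fun i => r (false, i, v)),
    fun X Y hX hY v => ?_⟩
  have hT : c * (16 * L + 3 * (P * Q)) =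
      8 * L * c + 2 * (P * Q) * c + P * Q * c + 8 * L * c := by ring
  rw [hT, CliqueAlgorithm.outputAfter_mapOutput]
  exact Prod.ext (funext fun j => hA ⟨X, Y, hX, hY⟩ (true, v, j))
    (funext fun i => hA ⟨X, Y, hX, hY⟩ (false, i, v))

/-- Over all finite fields of characteristic at least `q`, the product of an `n × ⌈n ^ γ⌉` by an
`⌈n ^ γ⌉ × n` matrix has an algebraic algorithm of rank at most `K * n ^ σ`. This is the bound
inside `IsMMExponentBound`, with its constant made explicit. -/
def HasUniformRankLE (q : ℕ) (γ K σ : ℝ) : Prop :=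
  ∀ (F : Type) [Field F] [Finite F], q ≤ ringChar F → ∀ n : ℕ, 1 ≤ n →
    ∃ t : ℕ, (t : ℝ) ≤ K * (n : ℝ) ^ σ ∧ HasAlgebraicAlgorithm F n ⌈(n : ℝ) ^ γ⌉₊ t

theorem exists_finite_field_le_ringChar (q : ℕ) :
    ∃ (F : Type) (_ : Field F) (_ : Finite F), q ≤ ringChar F := by
  obtain ⟨p, hqp, hp⟩ := Nat.exists_infinite_primes q
  have : Fact p.Prime := ⟨hp⟩
  exact ⟨ZMod p, inferInstance, inferInstance, by rwa [ZMod.ringChar_zmod_n]⟩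

theorem one_le_ceil_rpow {n : ℕ} (hn : 1 ≤ n) (γ : ℝ) : 1 ≤ ⌈(n : ℝ) ^ γ⌉₊ :=
  Nat.one_le_ceil_iff.2 (Real.rpow_pos_of_pos (by exact_mod_cast hn) γ)

namespace HasUniformRankLE

variable {q : ℕ} {γ γ' K K' σ σ' : ℝ}

theorem const_nonneg (h : HasUniformRankLE q γ K σ) : 0 ≤ K := by
  obtain ⟨F, _, _, hF⟩ := exists_finite_field_le_ringChar q
  obtain ⟨t, ht, -⟩ := h F hF 1 le_rfl
  exact t.cast_nonneg.trans (by simpa using ht)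

theorem mono (h : HasUniformRankLE q γ K σ) (hK : K ≤ K') (hσ : σ ≤ σ') :
    HasUniformRankLE q γ K' σ' := by
  intro F _ _ hF n hn
  obtain ⟨t, ht, halg⟩ := h F hF n hn
  have hn1 : (1 : ℝ) ≤ n := by exact_mod_cast hn
  have hK' : 0 ≤ K' := h.const_nonneg.trans hK
  exact ⟨t, ht.trans (by gcongr), halg⟩

theorem antitone (h : HasUniformRankLE q γ' K σ) (hγ : γ ≤ γ') : HasUniformRankLE q γ K σ := by
  intro F _ _ hF n hn
  obtain ⟨t, ht, halg⟩ := h F hF n hn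
  have hn1 : (1 : ℝ) ≤ n := by exact_mod_cast hn
  have hsplit := halg.split (m' := ⌈(n : ℝ) ^ γ⌉₊) (r := 1) (by rw [mul_one]; gcongr)
  exact ⟨t, ht, by rwa [one_mul] at hsplit⟩

theorem add (h : HasUniformRankLE q γ K σ) (hγ : γ ≤ γ') :
    HasUniformRankLE q γ' (2 * K) (σ + (γ' - γ)) := by
  intro F _ _ hF n hn
  obtain ⟨t, ht, halg⟩ := h F hF n hn
  have hn1 : (1 : ℝ) ≤ n := by exact_mod_cast hn
  have hn0 : (0 : ℝ) < n := by positivity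
  have hr : (⌈(n : ℝ) ^ (γ' - γ)⌉₊ : ℝ) ≤ 2 * (n : ℝ) ^ (γ' - γ) :=
    Nat.ceil_le_two_mul (by linarith [Real.one_le_rpow hn1 (sub_nonneg.2 hγ)])
  refine ⟨⌈(n : ℝ) ^ (γ' - γ)⌉₊ * t, ?_, halg.split (Nat.ceil_le.2 ?_)⟩
  · calc ((⌈(n : ℝ) ^ (γ' - γ)⌉₊ * t : ℕ) : ℝ)
        ≤ (2 * (n : ℝ) ^ (γ' - γ)) * (K * (n : ℝ) ^ σ) := by push_cast; gcongr
      _ = 2 * K * (n : ℝ) ^ (σ + (γ' - γ)) := by rw [Real.rpow_add hn0]; ring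
  · calc (n : ℝ) ^ γ' = (n : ℝ) ^ γ * (n : ℝ) ^ (γ' - γ) := by
          rw [← Real.rpow_add hn0, add_sub_cancel]
      _ ≤ ((⌈(n : ℝ) ^ γ⌉₊ * ⌈(n : ℝ) ^ (γ' - γ)⌉₊ : ℕ) : ℝ) := by
          push_cast
          gcongr <;> exact Nat.le_ceil _

theorem two_le (h : HasUniformRankLE q γ K σ) : 2 ≤ σ := by
  by_contra! hσ
  obtain ⟨F, _, _, hF⟩ := exists_finite_field_le_ringChar q
  have hbdd : ∀ n : ℕ, 1 ≤ n → (n : ℝ) ^ (2 - σ) ≤ K := by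
    intro n hn
    obtain ⟨t, ht, halg⟩ := h F hF n hn
    have hn0 : (0 : ℝ) < n := by exact_mod_cast hn
    have hsq : (n : ℝ) * n ≤ t := by exact_mod_cast halg.sq_le (one_le_ceil_rpow hn γ)
    rw [Real.rpow_sub hn0, div_le_iff₀ (by positivity), Real.rpow_two, sq]
    exact hsq.trans ht
  have hlim : Filter.Tendsto (fun n : ℕ => (n : ℝ) ^ (2 - σ)) Filter.atTop Filter.atTop :=
    (tendsto_rpow_atTop (by linarith)).comp tendsto_natCast_atTop_atTop
  obtain ⟨n, hnK, hn⟩ := ((hlim.eventually_gt_atTop K).and (Filter.eventually_ge_atTop 1)).exists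
  exact (hbdd n hn).not_gt hnK

end HasUniformRankLE

theorem hasUniformRankLE_zero (q : ℕ) : HasUniformRankLE q 0 1 2 := fun F _ _ _ n _ =>
  ⟨n * n, by simp [sq], by simpa using hasAlgebraicAlgorithm_one F n⟩

theorem IsMMExponentBound.exists_hasUniformRankLE {q : ℕ} {γ τ ε : ℝ}
    (h : IsMMExponentBound q γ τ) (hε : 0 < ε) : ∃ K, HasUniformRankLE q γ K (τ + ε) :=
  h ε hε

theorem IsMMExponentBound.two_le {q : ℕ} {γ τ : ℝ} (h : IsMMExponentBound q γ τ) : 2 ≤ τ :=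
  le_of_forall_pos_le_add fun _ hε => (h.exists_hasUniformRankLE hε).choose_spec.two_le

theorem IsMMExponentBound.antitone {q : ℕ} {γ γ' τ : ℝ} (h : IsMMExponentBound q γ' τ)
    (hγ : γ ≤ γ') : IsMMExponentBound q γ τ := fun _ hε =>
  let ⟨K, hK⟩ := h.exists_hasUniformRankLE hε
  ⟨K, hK.antitone hγ⟩

theorem IsMMExponentBound.add {q : ℕ} {γ γ' τ : ℝ} (h : IsMMExponentBound q γ τ)
    (hγ : γ ≤ γ') : IsMMExponentBound q γ' (τ + (γ' - γ)) := fun ε hε =>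
  let ⟨K, hK⟩ := h.exists_hasUniformRankLE hε
  ⟨2 * K, add_right_comm τ ε (γ' - γ) ▸ hK.add hγ⟩

theorem isMMExponentBound_zero (q : ℕ) : IsMMExponentBound q 0 2 := fun _ hε =>
  ⟨1, (hasUniformRankLE_zero q).mono le_rfl (by linarith)⟩

theorem nonempty_isMMExponentBound (q : ℕ) (γ : ℝ) : {τ | IsMMExponentBound q γ τ}.Nonempty :=
  ⟨_, ((isMMExponentBound_zero q).add (le_max_right γ 0)).antitone (le_max_left γ 0)⟩

theorem mmExponent_le {q : ℕ} {γ τ : ℝ} (h : IsMMExponentBound q γ τ) : mmExponent q γ ≤ τ :=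
  csInf_le ⟨2, fun _ h => h.two_le⟩ h

theorem two_le_mmExponent (q : ℕ) (γ : ℝ) : 2 ≤ mmExponent q γ :=
  le_csInf (nonempty_isMMExponentBound q γ) fun _ h => h.two_le

theorem isMMExponentBound_mmExponent (q : ℕ) (γ : ℝ) :
    IsMMExponentBound q γ (mmExponent q γ) := by
  intro ε hε
  obtain ⟨τ, hτ, hlt⟩ := exists_lt_of_csInf_lt (nonempty_isMMExponentBound q γ)
    (lt_add_of_pos_right (mmExponent q γ) (half_pos hε))
  obtain ⟨K, hK⟩ := hτ.exists_hasUniformRankLE (half_pos hε)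
  exact ⟨K, hK.mono le_rfl (by linarith)⟩

theorem mmExponent_monotone (q : ℕ) : Monotone (mmExponent q) := fun _ γ' h =>
  mmExponent_le ((isMMExponentBound_mmExponent q γ').antitone h)

theorem mmExponent_le_add_sub {q : ℕ} {γ γ' : ℝ} (hγ : γ ≤ γ') :
    mmExponent q γ' ≤ mmExponent q γ + (γ' - γ) :=
  mmExponent_le ((isMMExponentBound_mmExponent q γ).add hγ)

theorem mmExponent_continuous (q : ℕ) : Continuous (mmExponent q) := by
  refine (LipschitzWith.of_le_add fun x y => ?_ : LipschitzWith 1 (mmExponent q)).continuous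
  rcases le_total x y with h | h
  · exact (mmExponent_monotone q h).trans (le_add_of_nonneg_right dist_nonneg)
  · rw [Real.dist_eq, abs_of_nonneg (sub_nonneg.2 h)]
    exact mmExponent_le_add_sub h

theorem mmExponent_zero (q : ℕ) : mmExponent q 0 = 2 :=
  le_antisymm (mmExponent_le (isMMExponentBound_zero q)) (two_le_mmExponent q 0)

theorem exists_hasUniformRankLE_mmExponent (q : ℕ) {ε : ℝ} (hε : 0 < ε) :
    ∃ K, ∀ γ ∈ Set.Icc (0 : ℝ) 1, ∃ γ' ∈ Set.Icc γ 1,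
      HasUniformRankLE q γ' K (mmExponent q γ + ε) := by
  -- A grid of mesh `ε / 2` suffices, since rounding `γ` up to it raises `ω` by at most `ε / 2`.
  obtain ⟨N, hN⟩ := exists_nat_gt (2 / ε)
  have hN0 : (0 : ℝ) < N := lt_trans (by positivity) hN
  choose K hK using fun j : ℕ =>
    (isMMExponentBound_mmExponent q (j / N)).exists_hasUniformRankLE (half_pos hε)
  refine ⟨∑ j ∈ Finset.range (N + 1), K j, fun γ ⟨hγ0, hγ1⟩ => ?_⟩
  have hj : ⌈γ * N⌉₊ ≤ N := Nat.ceil_le.2 (mul_le_of_le_one_left hN0.le hγ1)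
  have hle : γ ≤ (⌈γ * N⌉₊ : ℝ) / N := (le_div_iff₀ hN0).2 (Nat.le_ceil _)
  have hmesh : (⌈γ * N⌉₊ : ℝ) / N ≤ γ + ε / 2 := by
    rw [div_lt_iff₀ hε] at hN
    rw [div_le_iff₀ hN0]
    linarith [Nat.ceil_lt_add_one (show 0 ≤ γ * N by positivity)]
  refine ⟨⌈γ * N⌉₊ / N, ⟨hle, (div_le_one hN0).2 (by exact_mod_cast hj)⟩, (hK ⌈γ * N⌉₊).mono ?_ ?_⟩
  · exact Finset.single_le_sum (fun j _ => (hK j).const_nonneg) (Finset.mem_range.2 (by lia))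
  · linarith [mmExponent_le_add_sub (q := q) hle]

theorem exists_isBalancedExponent (q : ℕ) {n m M : ℕ} (hn : 2 ≤ n) (hM : 1 ≤ M) (hmn : m ≤ n)
    (h : M * n ≤ m ^ 2) : ∃ γ, IsBalancedExponent q n m M γ := by
  have hn0 : (0 : ℝ) < n := by positivity
  have hM0 : (0 : ℝ) < M := by exact_mod_cast hM
  have hm0 : (0 : ℝ) < m := by exact_mod_cast Nat.pos_of_ne_zero (by rintro rfl; nlinarith)
  have hlog : 0 < Real.log n := Real.log_pos (by exact_mod_cast hn)
  set μ := Real.log M / Real.log n with hμ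
  set l := Real.log m / Real.log n with hl
  have hμl : μ + 1 ≤ 2 * l := by
    have hsum : Real.log M + Real.log n ≤ 2 * Real.log m := by
      rw [← Real.log_mul hM0.ne' hn0.ne', ← Real.log_rpow hm0, Real.rpow_two]
      exact Real.log_le_log (by positivity) (by exact_mod_cast h)
    rw [hμ, hl, div_add_one hlog.ne', ← mul_div_assoc]
    gcongr
  have hl1 : l ≤ 1 := (div_le_one hlog).2 (Real.log_le_log hm0 (by exact_mod_cast hmn))
  let gap (γ : ℝ) : ℝ := (1 - μ) * γ - (1 - μ + (l - 1) * mmExponent q γ)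
  have hgap : Continuous gap := by
    have := mmExponent_continuous q
    fun_prop
  have hgap0 : gap 0 ≤ 0 := by
    simp only [gap, mmExponent_zero]
    linarith
  have hgap1 : 0 ≤ gap 1 := by
    have := mul_nonneg (sub_nonneg.2 hl1) (zero_le_two.trans (two_le_mmExponent q 1))
    simp only [gap]
    linarith
  obtain ⟨γ, hγ, hzero⟩ := intermediate_value_Icc zero_le_one hgap.continuousOn ⟨hgap0, hgap1⟩
  exact ⟨γ, hγ.1, sub_eq_zero.1 hzero⟩

namespace IsBalancedExponent

variable {q n m M : ℕ} {γ : ℝ}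

theorem log_sub_mul (h : IsBalancedExponent q n m M γ) (hn : 2 ≤ n) :
    (Real.log n - Real.log M) * (1 - γ) = (Real.log n - Real.log m) * mmExponent q γ := by
  have hlog : 0 < Real.log n := Real.log_pos (by exact_mod_cast hn)
  have heq := h.2
  field_simp at heq
  linarith

theorem le_one (h : IsBalancedExponent q n m M γ) (hM : 1 ≤ M) (hMn : M < n) (hm : 1 ≤ m)
    (hmn : m ≤ n) : γ ≤ 1 := by
  have hM0 : (0 : ℝ) < M := by exact_mod_cast hM
  have hm0 : (0 : ℝ) < m := by exact_mod_cast hm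
  have hMlog : Real.log M < Real.log n := Real.log_lt_log hM0 (by exact_mod_cast hMn)
  have hmlog : Real.log m ≤ Real.log n := Real.log_le_log hm0 (by exact_mod_cast hmn)
  have hprod : 0 ≤ (Real.log n - Real.log M) * (1 - γ) := by
    rw [h.log_sub_mul (by lia)]
    exact mul_nonneg (sub_nonneg.2 hmlog) (zero_le_two.trans (two_le_mmExponent q γ))
  exact sub_nonneg.1 (nonneg_of_mul_nonneg_right hprod (sub_pos.2 hMlog))

theorem div_rpow_le (h : IsBalancedExponent q n m M γ) (hM : 1 ≤ M) (hMn : M < n) (hm : 1 ≤ m)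
    (hmn : m ≤ n) {d : ℝ} (hd : 0 < d) (hdω : d ^ mmExponent q γ ≤ n / M) :
    m / d ^ γ ≤ n / d := by
  have hM0 : (0 : ℝ) < M := by exact_mod_cast hM
  have hm0 : (0 : ℝ) < m := by exact_mod_cast hm
  have hn0 : (0 : ℝ) < n := by exact_mod_cast hm.trans hmn
  have hω : 0 < mmExponent q γ := zero_lt_two.trans_le (two_le_mmExponent q γ)
  have hlogd : mmExponent q γ * Real.log d ≤ Real.log n - Real.log M := by
    rw [← Real.log_rpow hd, ← Real.log_div hn0.ne' hM0.ne']
    exact Real.log_le_log (by positivity) hdω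
  have hbalance : (1 - γ) * Real.log d ≤ Real.log n - Real.log m := by
    refine le_of_mul_le_mul_right ?_ hω
    calc (1 - γ) * Real.log d * mmExponent q γ = (1 - γ) * (mmExponent q γ * Real.log d) := by ring
      _ ≤ (1 - γ) * (Real.log n - Real.log M) :=
        mul_le_mul_of_nonneg_left hlogd (sub_nonneg.2 (h.le_one hM hMn hm hmn))
      _ = (Real.log n - Real.log m) * mmExponent q γ := by rw [mul_comm, h.log_sub_mul (by lia)]
  rw [← Real.log_le_log_iff (by positivity) (by positivity), Real.log_div hm0.ne' (by positivity),
    Real.log_div hn0.ne' hd.ne', Real.log_rpow hd]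
  linarith

end IsBalancedExponent

theorem exists_prime_le_two_pow_clog (q : ℕ) {n : ℕ} (hn : 2 ≤ n) :
    ∃ p : ℕ, p.Prime ∧ q ≤ p ∧ 4 * n + 2 ≤ p ∧ p ≤ 2 ^ (Nat.clog 2 n * (2 * q + 11)) := by
  obtain ⟨p, hp, hlt, hle⟩ := Nat.exists_prime_lt_and_le_two_mul (q + 4 * n + 2) (by lia)
  refine ⟨p, hp, by lia, by lia, hle.trans ?_⟩
  have hclog : n ≤ 2 ^ Nat.clog 2 n := Nat.le_pow_clog one_lt_two n
  calc 2 * (q + 4 * n + 2) ≤ n * (2 * q + 10) := by nlinarith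
    _ ≤ n * n ^ (2 * q + 10) := Nat.mul_le_mul_left n
      (Nat.lt_two_pow_self.le.trans (Nat.pow_le_pow_left hn _))
    _ = n ^ (2 * q + 11) := by ring
    _ ≤ 2 ^ (Nat.clog 2 n * (2 * q + 11)) := by
      rw [pow_mul]
      exact Nat.pow_le_pow_left hclog _

theorem DistRoundsLE.mono {n m M : ℕ} {R R' : ℝ} (h : DistRoundsLE n m M R) (hR : R ≤ R') :
    DistRoundsLE n m M R' :=
  let ⟨T, hT, P⟩ := h
  ⟨T, hT.trans hR, P⟩

theorem le_mul_ceil_div {a d : ℕ} (hd : 1 ≤ d) : a ≤ d * ⌈(a : ℝ) / d⌉₊ := by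
  have hd0 : (0 : ℝ) < d := by exact_mod_cast hd
  have := (div_le_iff₀' hd0).1 (Nat.le_ceil ((a : ℝ) / d))
  exact_mod_cast this

theorem ceil_div_mul_ceil_div_le {n m d e : ℕ} (hd : 1 ≤ d) (hdn : d ≤ n) (he : 1 ≤ e) :
    (⌈(n : ℝ) / d⌉₊ * ⌈(m : ℝ) / e⌉₊ : ℝ) ≤ n * (2 * (m / (d * e) + n / d ^ 2)) := by
  have hd0 : (0 : ℝ) < d := by exact_mod_cast hd
  have : (0 : ℝ) < e := by exact_mod_cast he
  have hdn' : (d : ℝ) ≤ n := by exact_mod_cast hdn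
  have hrows : (⌈(n : ℝ) / d⌉₊ : ℝ) ≤ 2 * (n / d) :=
    Nat.ceil_le_two_mul (by linarith [(one_le_div hd0).2 hdn'])
  have hcols : (⌈(m : ℝ) / e⌉₊ : ℝ) ≤ m / e + 1 := (Nat.ceil_lt_add_one (by positivity)).le
  calc (⌈(n : ℝ) / d⌉₊ * ⌈(m : ℝ) / e⌉₊ : ℝ) ≤ 2 * (n / d) * (m / e + 1) := by gcongr
    _ = n * (2 * (m / (d * e) + d / d ^ 2)) := by field_simp
    _ ≤ n * (2 * (m / (d * e) + n / d ^ 2)) := by gcongr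

theorem distRoundsLE_of_blocks {q n m M d e Q : ℕ} (hn : 2 ≤ n) (hMn : M ≤ n) (hmn : m ≤ n)
    (he : 1 ≤ e) (hed : e ≤ d) (hdn : d * d ≤ n)
    (halg : ∀ (F : Type) [Field F] [Finite F], q ≤ ringChar F →
      ∃ t, (4 * M + 1) * t ≤ n * Q ∧ HasAlgebraicAlgorithm F d e t) :
    DistRoundsLE n m M (8 * (2 * q + 11) * (16 + 3 * Q) * (m / (d * e) + n / d ^ 2)) := by
  obtain ⟨p, hp, hqp, hnp, hpb⟩ := exists_prime_le_two_pow_clog q hn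
  have : Fact p.Prime := ⟨hp⟩
  obtain ⟨t, ht, halg⟩ := halg (ZMod p) (by rwa [ZMod.ringChar_zmod_n])
  have hd : 1 ≤ d := he.trans hed
  have : (0 : ℝ) < d := by exact_mod_cast hd
  have hnd : 1 ≤ (n : ℝ) / d ^ 2 :=
    (one_le_div (by positivity)).2 (by exact_mod_cast (sq d).trans_le hdn)
  set ρ : ℝ := 4 * (m / (d * e) + n / d ^ 2) with hρ
  have hme : (0 : ℝ) ≤ m / (d * e) := by positivity
  have hPρ : (⌈ρ⌉₊ : ℝ) ≤ 2 * ρ := Nat.ceil_le_two_mul (by linarith)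
  have howner : ⌈(n : ℝ) / d⌉₊ * ⌈(m : ℝ) / e⌉₊ ≤ n * ⌈ρ⌉₊ := by
    rify
    refine (ceil_div_mul_ceil_div_le hd ((Nat.le_mul_self d).trans hdn) he).trans ?_
    gcongr
    linarith [Nat.le_ceil ρ]
  have hcollector : ⌈(n : ℝ) / d⌉₊ * ⌈(n : ℝ) / d⌉₊ ≤ n * ⌈ρ⌉₊ := by
    rify
    refine (ceil_div_mul_ceil_div_le hd ((Nat.le_mul_self d).trans hdn) hd).trans ?_
    rw [← sq]
    gcongr
    linarith [Nat.le_ceil ρ]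
  obtain ⟨S⟩ := BlockScheme.nonempty_of_le (by rw [ZMod.card]; lia) halg
    (le_mul_ceil_div hd) (le_mul_ceil_div he) howner hcollector ht
  have hdd : ⌈ρ⌉₊ * (d * d) ≤ n * ⌈ρ⌉₊ := by
    rw [mul_comm n]
    gcongr
  refine ⟨_, ?_, S.exists_computesDist (p := p) (c := 2 * q + 11) (by lia)
    (by rw [ZMod.card]; lia) (by rwa [ZMod.card]) (hdd.trans' (by gcongr)) hdd⟩
  push_cast
  calc (2 * (q : ℝ) + 11) * (16 * ⌈ρ⌉₊ + 3 * (⌈ρ⌉₊ * Q))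
      = (2 * q + 11) * (16 + 3 * Q) * ⌈ρ⌉₊ := by ring
    _ ≤ (2 * q + 11) * (16 + 3 * Q) * (2 * ρ) := by gcongr
    _ = 8 * (2 * q + 11) * (16 + 3 * Q) * (m / (d * e) + n / d ^ 2) := by rw [hρ]; ring

theorem rpow_one_add_div_four_le {x γ : ℝ} (hx : 1 ≤ x) (hγ0 : 0 ≤ γ) (hγ1 : γ ≤ 1) :
    x ^ (1 + γ) / 4 ≤ ⌊x⌋₊ * ⌈(⌊x⌋₊ : ℝ) ^ γ⌉₊ := by
  have hx0 : 0 < x := by positivity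
  have hfloor : x / 2 ≤ ⌊x⌋₊ := (Nat.div_two_lt_floor hx).le
  calc x ^ (1 + γ) / 4 = x / 2 * (x ^ γ / 2 ^ (1 : ℝ)) := by
        rw [Real.rpow_add hx0, Real.rpow_one, Real.rpow_one]; ring
    _ ≤ x / 2 * (x ^ γ / 2 ^ γ) := by gcongr; norm_num
    _ = x / 2 * (x / 2) ^ γ := by rw [Real.div_rpow hx0.le zero_le_two]
    _ ≤ ⌊x⌋₊ * (⌊x⌋₊ : ℝ) ^ γ := by gcongr
    _ ≤ ⌊x⌋₊ * ⌈(⌊x⌋₊ : ℝ) ^ γ⌉₊ := by gcongr; exact Nat.le_ceil _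

theorem HasUniformRankLE.distRoundsLE {q : ℕ} {γ K σ : ℝ} (h : HasUniformRankLE q γ K σ)
    (hγ0 : 0 ≤ γ) (hγ1 : γ ≤ 1) {n m M : ℕ} (hn : 2 ≤ n) (hM : 1 ≤ M) (hmn : m ≤ n) {x : ℝ}
    (hx : 1 ≤ x) (hxσ : x ^ σ ≤ n / M) :
    DistRoundsLE n m M
      (32 * (2 * q + 11) * (16 + 3 * ⌈5 * K⌉₊) * (m / x ^ (1 + γ) + n / x ^ 2)) := by
  have hM1 : (1 : ℝ) ≤ M := by exact_mod_cast hM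
  have hx0 : 0 < x := by positivity
  have hK : 0 ≤ K := h.const_nonneg
  have hσ : 2 ≤ σ := h.two_le
  have hMn : M ≤ n := by
    have := (one_le_div (by positivity)).1 ((Real.one_le_rpow hx (by linarith)).trans hxσ)
    exact_mod_cast this
  have hd1 : 1 ≤ ⌊x⌋₊ := Nat.le_floor (by simpa using hx)
  set d := ⌊x⌋₊
  have hd1' : (1 : ℝ) ≤ d := by exact_mod_cast hd1
  have hdx : (d : ℝ) ≤ x := Nat.floor_le hx0.le
  have hxd : x / 2 ≤ d := (Nat.div_two_lt_floor hx).le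
  have hdσ : (d : ℝ) ^ σ ≤ n / M := hxσ.trans' (by gcongr)
  have hdn : d * d ≤ n := by
    rify
    calc (d : ℝ) * d = (d : ℝ) ^ (2 : ℝ) := by rw [Real.rpow_two, sq]
      _ ≤ (d : ℝ) ^ σ := by gcongr
      _ ≤ n := hdσ.trans (div_le_self (by positivity) hM1)
  have hed : ⌈(d : ℝ) ^ γ⌉₊ ≤ d :=
    Nat.ceil_le.2 (by simpa using Real.rpow_le_rpow_of_exponent_le hd1' hγ1)
  refine (distRoundsLE_of_blocks (q := q) (Q := ⌈5 * K⌉₊) hn hMn hmn (one_le_ceil_rpow hd1 γ) hed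
    hdn fun F _ _ hF => ?_).mono ?_
  · obtain ⟨t, ht, halg⟩ := h F hF d hd1
    refine ⟨t, ?_, halg⟩
    rify
    calc (4 * (M : ℝ) + 1) * t ≤ (4 * M + M) * (K * (n / M)) := by
          gcongr
          exact ht.trans (by gcongr)
      _ = n * (5 * K) := by field_simp; ring
      _ ≤ n * ⌈5 * K⌉₊ := by gcongr; exact Nat.le_ceil _
  · calc 8 * (2 * (q : ℝ) + 11) * (16 + 3 * ⌈5 * K⌉₊) *
          (m / (d * ⌈(d : ℝ) ^ γ⌉₊) + n / d ^ 2)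
        ≤ 8 * (2 * q + 11) * (16 + 3 * ⌈5 * K⌉₊) *
          (m / (x ^ (1 + γ) / 4) + n / (x / 2) ^ 2) := by
            gcongr
            exact rpow_one_add_div_four_le hx hγ0 hγ1
      _ = _ := by field_simp; ring

theorem distRoundsLE_schoolbook {n m M : ℕ} (hn : 2 ≤ n) (hM : 1 ≤ M) (hMn : M ≤ n)
    (hmn : m ≤ n) : DistRoundsLE n m M (10912 * (m / √(n / M) + M)) := by
  have hM0 : (0 : ℝ) < M := by exact_mod_cast hM
  have hnM : 1 ≤ (n : ℝ) / M := (one_le_div hM0).2 (by exact_mod_cast hMn)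
  have hsq : √((n : ℝ) / M) ^ 2 = n / M := Real.sq_sqrt (by positivity)
  convert (hasUniformRankLE_zero 0).distRoundsLE le_rfl zero_le_one hn hM hmn
    (Real.one_le_sqrt.2 hnM) (by rw [Real.rpow_two, hsq]) using 2
  · norm_num
  · rw [add_zero, Real.rpow_one, hsq, div_div_cancel₀ (by positivity)]

theorem distRoundsLE_linear {n m M : ℕ} (hn : 2 ≤ n) (hM : 1 ≤ M) (hMn : M ≤ n) (hmn : m ≤ n) :
    DistRoundsLE n m M (21824 * n) := by
  have hM0 : (0 : ℝ) < M := by exact_mod_cast hM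
  have hMn' : (M : ℝ) ≤ n := by exact_mod_cast hMn
  have hm : m / √((n : ℝ) / M) ≤ n :=
    (div_le_self m.cast_nonneg (Real.one_le_sqrt.2 ((one_le_div hM0).2 hMn'))).trans
      (by exact_mod_cast hmn)
  exact (distRoundsLE_schoolbook hn hM hMn hmn).mono (by linarith)

theorem distRoundsLE_of_le_sqrt {n m M : ℕ} {L : ℝ} (hn : 2 ≤ n) (hM : 1 ≤ M) (hMn : M ≤ n)
    (hmn : m ≤ n) (hL : 1 ≤ L) (h : (m : ℝ) ≤ √(M * n * L)) :
    DistRoundsLE n m M (21824 * (M * L)) := by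
  have hM0 : (0 : ℝ) < M := by exact_mod_cast hM
  have : (0 : ℝ) < n := by positivity
  have hm : m / √((n : ℝ) / M) ≤ M * L := by
    rw [div_le_iff₀ (by positivity)]
    calc (m : ℝ) ≤ √(M * n * L) := h
      _ ≤ √(M * n * L * L) := Real.sqrt_le_sqrt (le_mul_of_one_le_right (by positivity) hL)
      _ = √((M * L) ^ 2 * (n / M)) := by congr 1; field_simp
      _ = M * L * √(n / M) := by rw [Real.sqrt_mul (by positivity), Real.sqrt_sq (by positivity)]
  have hML : (M : ℝ) ≤ M * L := le_mul_of_one_le_right hM0.le hL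
  exact (distRoundsLE_schoolbook hn hM hMn hmn).mono (by linarith)

theorem distRoundsLE_of_sq_div_le {n m M : ℕ} {L : ℝ} (hn : 2 ≤ n) (hM : 1 ≤ M) (hMn : M ≤ n)
    (hmn : m ≤ n) (hL : 1 ≤ L) (h : (n : ℝ) ^ 2 / (M * L) ≤ m) :
    DistRoundsLE n m M (21824 * (m * M * L / n)) := by
  have : (0 : ℝ) < M := by exact_mod_cast hM
  have hn0 : (0 : ℝ) < n := by positivity
  refine (distRoundsLE_linear hn hM hMn hmn).mono ?_
  gcongr
  rw [le_div_iff₀ hn0, ← sq, mul_assoc]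
  exact (div_le_iff₀ (by positivity)).1 h

theorem div_rpow_one_div_sq {a b : ℝ} (ha : 0 < a) (hb : 0 < b) (σ : ℝ) :
    a / ((a / b) ^ (1 / σ)) ^ 2 = b ^ (2 / σ) * a ^ (1 - 2 / σ) := by
  rw [← Real.rpow_mul_natCast (by positivity), Nat.cast_ofNat, one_div_mul_eq_div,
    Real.div_rpow ha.le hb.le, Real.rpow_sub ha, Real.rpow_one]
  field_simp

theorem distRoundsLE_of_isBalancedExponent_of_lt (q : ℕ) {ε : ℝ} (hε : 0 < ε) :
    ∃ C : ℝ, ∀ n m M : ℕ, 1 ≤ M → M < n → 1 ≤ m → m ≤ n → ∀ γ, IsBalancedExponent q n m M γ →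
      DistRoundsLE n m M (C * ((M : ℝ) ^ (2 / (mmExponent q γ + ε)) *
        (n : ℝ) ^ (1 - 2 / (mmExponent q γ + ε)))) := by
  obtain ⟨K, hK⟩ := exists_hasUniformRankLE_mmExponent q hε
  refine ⟨32 * (2 * q + 11) * (16 + 3 * ⌈5 * K⌉₊) * 2, fun n m M hM hMn hm hmn γ hγ => ?_⟩
  obtain ⟨γ', ⟨hγγ', hγ'1⟩, hrank⟩ := hK γ ⟨hγ.1, hγ.le_one hM hMn hm hmn⟩
  have hσ := hrank.two_le
  set ω := mmExponent q γ
  have hM0 : (0 : ℝ) < M := by exact_mod_cast hM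
  have hn0 : (0 : ℝ) < n := by exact_mod_cast hm.trans hmn
  have hnM : 1 ≤ (n : ℝ) / M := (one_le_div hM0).2 (by exact_mod_cast hMn.le)
  set x := ((n : ℝ) / M) ^ (1 / (ω + ε)) with hx
  have hx1 : 1 ≤ x := Real.one_le_rpow hnM (by positivity)
  have hx0 : 0 < x := by positivity
  have hxσ : x ^ (ω + ε) = n / M := by
    rw [hx, one_div, Real.rpow_inv_rpow (by positivity) (by positivity)]
  have hbalance : m / x ^ (1 + γ') ≤ n / x ^ 2 := by
    have hxω : x ^ ω ≤ n / M := hxσ ▸ Real.rpow_le_rpow_of_exponent_le hx1 (by linarith)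
    calc m / x ^ (1 + γ') = m / x ^ γ' / x := by
          rw [Real.rpow_add hx0, Real.rpow_one, mul_comm, div_div]
      _ ≤ m / x ^ γ / x := by gcongr
      _ ≤ n / x / x := div_le_div_of_nonneg_right (hγ.div_rpow_le hM hMn hm hmn hx0 hxω) hx0.le
      _ = n / x ^ 2 := by rw [div_div, sq]
  refine (hrank.distRoundsLE (hγ.1.trans hγγ') hγ'1 (by lia) hM hmn hx1 hxσ.le).mono ?_
  rw [← div_rpow_one_div_sq hn0 hM0, mul_assoc _ (2 : ℝ), ← hx]
  gcongr
  linarith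

theorem distRoundsLE_of_isBalancedExponent (q : ℕ) {ε : ℝ} (hε : 0 < ε) :
    ∃ C : ℝ, 0 ≤ C ∧ ∀ n m M : ℕ, 2 ≤ n → 1 ≤ M → M ≤ n → 1 ≤ m → m ≤ n →
      ∀ γ, IsBalancedExponent q n m M γ →
        DistRoundsLE n m M (C * ((M : ℝ) ^ (2 / (mmExponent q γ + ε)) *
          (n : ℝ) ^ (1 - 2 / (mmExponent q γ + ε)))) := by
  obtain ⟨C, hC⟩ := distRoundsLE_of_isBalancedExponent_of_lt q hε
  refine ⟨max C 21824, by positivity, fun n m M hn hM hMn hm hmn γ hγ => ?_⟩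
  rcases hMn.lt_or_eq with hlt | rfl
  · refine (hC n m M hM hlt hm hmn γ hγ).mono ?_
    gcongr
    exact le_max_left _ _
  · refine (distRoundsLE_linear hn hM le_rfl hmn).mono ?_
    rw [← Real.rpow_add (by positivity), add_sub_cancel, Real.rpow_one]
    gcongr
    exact le_max_right _ _

theorem theorem6_general :
    (∃ C : ℝ, ∀ n m M : ℕ, ∀ L : ℝ, 2 ≤ n → 1 ≤ M → M ≤ n → m ≤ n → 1 ≤ L →
      ((m : ℝ) ≤ √(M * n * L) → DistRoundsLE n m M (C * (M * L))) ∧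
      ((n : ℝ) ^ 2 / (M * L) ≤ m → DistRoundsLE n m M (C * (m * M * L / n)))) ∧
    (∀ q : ℕ, ∀ ε : ℝ, 0 < ε → ∃ C : ℝ, ∀ n m M : ℕ, ∀ L : ℝ,
      2 ≤ n → 1 ≤ M → M ≤ n → 1 ≤ m → m ≤ n → 1 ≤ L →
        (√(M * n * L) ≤ m → ∃ γ : ℝ, IsBalancedExponent q n m M γ) ∧
        ∀ γ : ℝ, IsBalancedExponent q n m M γ →
          DistRoundsLE n m M (C * ((M * L) ^ (2 / (mmExponent q γ + ε)) *
            (n : ℝ) ^ (1 - 2 / (mmExponent q γ + ε))))) := by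
  refine ⟨⟨21824, fun n m M L hn hM hMn hmn hL => ⟨distRoundsLE_of_le_sqrt hn hM hMn hmn hL,
    distRoundsLE_of_sq_div_le hn hM hMn hmn hL⟩⟩, fun q ε hε => ?_⟩
  obtain ⟨C, hC0, hC⟩ := distRoundsLE_of_isBalancedExponent q hε
  refine ⟨C, fun n m M L hn hM hMn hm hmn hL => ⟨fun h => ?_, fun γ hγ => ?_⟩⟩
  · refine exists_isBalancedExponent q hn hM hmn ?_
    rify
    exact (le_mul_of_one_le_right (by positivity) hL).trans (Real.sqrt_le_left m.cast_nonneg |>.1 h)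
  · have hω := two_le_mmExponent q γ
    refine (hC n m M hn hM hMn hm hmn γ hγ).mono ?_
    gcongr
    exact le_mul_of_one_le_right (by positivity) hL

theorem one_le_logb_two {m : ℕ} (hm : 2 ≤ m) : 1 ≤ Real.logb 2 m := by
  rw [Real.le_logb_iff_rpow_le one_lt_two (by positivity), Real.rpow_one]
  exact_mod_cast hm

theorem theorem6 :
    (∃ C : ℝ, ∀ n m M : ℕ, 1 ≤ M → M ≤ n → 2 ≤ m → m ≤ n →
      ((m : ℝ) ≤ √(M * n * Real.logb 2 m) →
        DistRoundsLE n m M (C * (M * Real.logb 2 m))) ∧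
      ((n : ℝ) ^ 2 / (M * Real.logb 2 m) ≤ m →
        DistRoundsLE n m M (C * (m * M * Real.logb 2 m / n)))) ∧
    (∀ q : ℕ, ∀ ε : ℝ, 0 < ε → ∃ C : ℝ, ∀ n m M : ℕ, 1 ≤ M → M ≤ n → 2 ≤ m → m ≤ n →
      √(M * n * Real.logb 2 m) ≤ m → (m : ℝ) ≤ (n : ℝ) ^ 2 / (M * Real.logb 2 m) →
        (∃ γ : ℝ, IsBalancedExponent q n m M γ) ∧
        ∀ γ : ℝ, IsBalancedExponent q n m M γ →
          DistRoundsLE n m M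
            (C * ((M * Real.logb 2 m) ^ (2 / (mmExponent q γ + ε)) *
              (n : ℝ) ^ (1 - 2 / (mmExponent q γ + ε))))) :=
  ⟨theorem6_general.1.imp fun _ hC n m M hM hMn hm hmn =>
    hC n m M _ (hm.trans hmn) hM hMn hmn (one_le_logb_two hm),
  fun q ε hε => (theorem6_general.2 q ε hε).imp fun _ hC n m M hM hMn hm hmn hle _ =>
    (hC n m M _ (hm.trans hmn) hM hMn (one_le_two.trans hm) hmn (one_le_logb_two hm)).imp_left
      fun hγ => hγ hle⟩
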